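/- Let $n\ge 2$, let $p\ge n$ be real, let $K\subset\mathbb{R}^n$ be a nonempty compact set, and let $\mathcal{A}$ be a vector field satisfying, for some constants $\gamma,\Gamma>0$: (v) $\mathcal{A}\in C(\overline{\mathbb{R}^n\setminus K}\times\mathbb{R}^n;\mathbb{R}^n)\cap C^1(\overline{\mathbb{R}^n\setminus K}\times(\mathbb{R}^n\setminus\{0\});\mathbb{R}^n)$, where $C^1$ up to the closure means that $\mathcal{A}$ is $C^1$ on $(\mathbb{R}^n\setminus K)\times(\mathbb{R}^n\setminus\{0\})$ and its first derivatives extend continuously to $\overline{\mathbb{R}^n\setminus K}\times(\mathbb{R}^n\setminus\{0\})$; (vi) $\mathcal{A}(x,0)=0$ for $x\in\mathbb{R}^n\setminus K$; (vii) $\sum_{i,j=1}^n\left|\frac{\partial\mathcal{A}_j(x,\eta)}{\partial\eta_i}\right|\le\Gamma|\eta|^{p-2}$ for $x\in\mathbb{R}^n\setminus K$ and $\eta\in\mathbb{R}^n\setminus\{0\}$; (viii) $\sum_{i,j=1}^n\frac{\partial\mathcal{A}_j(x,\eta)}{\partial\eta_i}\,\xi_i\xi_j\ge\gamma|\xi|^2|\eta|^{p-2}$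 for $x\in\mathbb{R}^n\setminus K$, $\eta\in\mathbb{R}^n\setminus\{0\}$ and $\xi\in\mathbb{R}^n$. Let $f_1,f_2$ be real functions on $\mathbb{R}^n\setminus K$ such that $f_1,f_2\in L^1(\mathbb{R}^n\setminus U)$ for every open set $U\supset K$, and $f_1\le f_2$ almost everywhere in $\mathbb{R}^n\setminus K$. Let $u,v\in C^0(\overline{\mathbb{R}^n\setminus K})\cap W^{1,p}_{\mathrm{loc}}(\mathbb{R}^n\setminus K)\cap L^\infty(\mathbb{R}^n\setminus K)$ satisfy $$-\operatorname{div}\mathcal{A}(x,\nabla u)=f_1,\qquad -\operatorname{div}\mathcal{A}(x,\nabla v)=f_2\qquad\text{in }\mathbb{R}^n\setminus K$$ in the weak sense, i.e. $\int_{\mathbb{R}^n\setminus K}\mathcal{A}(x,\nabla u)\cdot\nabla\varphi\,dx=\int_{\mathbb{R}^n\setminus K}f_1\varphi\,dx$ for all $\varphi\in C_c^\infty(\mathbb{R}^n\setminus K)$, and likewise for $v$ and $f_2$. If $v\ge u$ on $\partial K$, then $v\ge u$ in $\mathbb{R}^n\setminus K$. -/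

import Mathlib

open MeasureTheory Set
open scoped ContDiff Gradient

namespace ExteriorComparison

/-- `φ ∈ C_c^∞(Ω)`. -/
structure IsTestFunction {n : ℕ} (Ω : Set (EuclideanSpace ℝ (Fin n)))
    (φ : EuclideanSpace ℝ (Fin n) → ℝ) : Prop where
  smooth : ContDiff ℝ ∞ φ
  compact_support : HasCompactSupport φ
  support_subset : tsupport φ ⊆ Ω

/-- `g ∈ L^p_loc(Ω)`: `g` is in `L^p` of every compact subset of `Ω`. -/
def MemLpLoc {n : ℕ} {F : Type*} [NormedAddCommGroup F]
    (Ω : Set (EuclideanSpace ℝ (Fin n))) (p : ℝ)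
    (g : EuclideanSpace ℝ (Fin n) → F) : Prop :=
  ∀ C : Set (EuclideanSpace ℝ (Fin n)), IsCompact C → C ⊆ Ω →
    MemLp g (ENNReal.ofReal p) (volume.restrict C)

/-- `G` is a weak (distributional) gradient of `u` in the open set `Ω`. -/
structure HasWeakGradient {n : ℕ} (Ω : Set (EuclideanSpace ℝ (Fin n)))
    (u : EuclideanSpace ℝ (Fin n) → ℝ)
    (G : EuclideanSpace ℝ (Fin n) → EuclideanSpace ℝ (Fin n)) : Prop where
  locallyIntegrable : LocallyIntegrableOn u Ω volume
  locallyIntegrable_grad : LocallyIntegrableOn G Ω volume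
  integral_eq : ∀ φ : EuclideanSpace ℝ (Fin n) → ℝ, IsTestFunction Ω φ →
    ∫ x in Ω, u x • ∇ φ x = - ∫ x in Ω, φ x • G x

/-- `u ∈ W^{1,p}_loc(Ω)`. -/
def MemW1pLoc {n : ℕ} (Ω : Set (EuclideanSpace ℝ (Fin n))) (p : ℝ)
    (u : EuclideanSpace ℝ (Fin n) → ℝ) : Prop :=
  MemLpLoc Ω p u ∧
    ∃ G : EuclideanSpace ℝ (Fin n) → EuclideanSpace ℝ (Fin n),
      HasWeakGradient Ω u G ∧ MemLpLoc Ω p G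

/-- `-div 𝒜(x, ∇u) = f` in `Ω` in the weak sense. The weak gradient `G = ∇u` is unique up to
a null set, so the choice of `G` does not matter. -/
def IsWeakSolution {n : ℕ} (Ω : Set (EuclideanSpace ℝ (Fin n)))
    (A : EuclideanSpace ℝ (Fin n) → EuclideanSpace ℝ (Fin n) → EuclideanSpace ℝ (Fin n))
    (u f : EuclideanSpace ℝ (Fin n) → ℝ) : Prop :=
  ∃ G : EuclideanSpace ℝ (Fin n) → EuclideanSpace ℝ (Fin n), HasWeakGradient Ω u G ∧
    ∀ φ : EuclideanSpace ℝ (Fin n) → ℝ, IsTestFunction Ω φ →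
      IntegrableOn (fun x => inner ℝ (A x (G x)) (∇ φ x)) Ω volume ∧
      IntegrableOn (fun x => f x * φ x) Ω volume ∧
      ∫ x in Ω, inner ℝ (A x (G x)) (∇ φ x) = ∫ x in Ω, f x * φ x

/-- The partial derivative `∂𝒜_j(x, η) / ∂η_i`. -/
noncomputable def partialEta {n : ℕ}
    (A : EuclideanSpace ℝ (Fin n) → EuclideanSpace ℝ (Fin n) → EuclideanSpace ℝ (Fin n))
    (x η : EuclideanSpace ℝ (Fin n)) (i j : Fin n) : ℝ :=
  (fderiv ℝ (A x) η (EuclideanSpace.single i (1 : ℝ))) j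

/-- The structure conditions on the vector field `𝒜` over the exterior of `K`.
The field `contDiff` says that `𝒜` is `C^1` on `(ℝⁿ ∖ K) × (ℝⁿ ∖ {0})` and that its first
derivative extends continuously to `closure (ℝⁿ ∖ K) × (ℝⁿ ∖ {0})`. -/
structure StructureConditions {n : ℕ} (K : Set (EuclideanSpace ℝ (Fin n))) (p : ℝ)
    (A : EuclideanSpace ℝ (Fin n) → EuclideanSpace ℝ (Fin n) → EuclideanSpace ℝ (Fin n)) :
    Prop where
  continuousOn : ContinuousOn (Function.uncurry A) (closure Kᶜ ×ˢ univ)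
  contDiff : ∃ D : EuclideanSpace ℝ (Fin n) × EuclideanSpace ℝ (Fin n) →
      (EuclideanSpace ℝ (Fin n) × EuclideanSpace ℝ (Fin n) →L[ℝ] EuclideanSpace ℝ (Fin n)),
    ContinuousOn D (closure Kᶜ ×ˢ {0}ᶜ) ∧
      ∀ z ∈ Kᶜ ×ˢ {0}ᶜ, HasFDerivAt (Function.uncurry A) (D z) z
  map_zero : ∀ x ∈ Kᶜ, A x 0 = 0
  growth : ∃ Γ : ℝ, 0 < Γ ∧ ∀ x ∈ Kᶜ, ∀ η : EuclideanSpace ℝ (Fin n), η ≠ 0 →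
    ∑ i, ∑ j, |partialEta A x η i j| ≤ Γ * ‖η‖ ^ (p - 2)
  elliptic : ∃ γ : ℝ, 0 < γ ∧ ∀ x ∈ Kᶜ, ∀ η : EuclideanSpace ℝ (Fin n), η ≠ 0 →
    ∀ ξ : EuclideanSpace ℝ (Fin n),
      γ * ‖ξ‖ ^ 2 * ‖η‖ ^ (p - 2) ≤ ∑ i, ∑ j, partialEta A x η i j * ξ i * ξ j

end ExteriorComparison

/-!
Set `w = h(u - v)` with `h` smooth, nondecreasing, bounded, `h = 0` on `(-∞, ε]` and `h > 0` on
`(ε, ∞)`. By the boundary condition `w` vanishes near `K`, so `w` times a cutoff `η_R` at infinity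
is an admissible test function and, as `f₁ ≤ f₂`,
`∫ η_R ⟨𝒜(x, ∇u) - 𝒜(x, ∇v), ∇w⟩ ≤ -∫ w ⟨𝒜(x, ∇u) - 𝒜(x, ∇v), ∇η_R⟩`.
Since `p ≥ n`, the norms `‖∇η_R‖_p` stay bounded as `R → ∞`. Testing each equation with its own
solution times the `m`-th power of a cutoff, `m ≥ p`, therefore gives `∇u, ∇v ∈ L^p` near infinity
(Caccioppoli), so `𝒜(x, ∇u)` and `𝒜(x, ∇v)` are in `L^{p'}` there and Hölder's inequality sends the
right-hand side to `0`. Strict monotonicity of `𝒜(x, ·)` then forces `∇w = 0`; extended by zero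
across `K`, the function `w` is constant, hence zero, and `u ≤ v + ε` for every `ε > 0`.
-/

namespace ExteriorComparison

open Filter Topology Metric Convolution

section Measure

open scoped ENNReal

variable {X Y F : Type*} [MeasurableSpace X] [MeasurableSpace Y] [NormedAddCommGroup F]
  {μ : Measure X}

theorem ae_eq_zero_of_tendsto_integral_zero {f : ℕ → X → ℝ} {g : X → ℝ}
    (hf : ∀ k, 0 ≤ᵐ[μ] f k) (hfi : ∀ k, Integrable (f k) μ)
    (hlim : Tendsto (fun k => ∫ x, f k x ∂μ) atTop (𝓝 0))
    (hfg : ∀ᵐ x ∂μ, Tendsto (fun k => f k x) atTop (𝓝 (g x))) : g =ᵐ[μ] 0 := by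
  have hnorm : ∀ k, eLpNorm (f k - 0) 1 μ = ENNReal.ofReal (∫ x, f k x ∂μ) := fun k => by
    rw [sub_zero, eLpNorm_one_eq_lintegral_enorm,
      ofReal_integral_eq_lintegral_ofReal (hfi k) (hf k)]
    refine lintegral_congr_ae ?_
    filter_upwards [hf k] with x hx
    exact Real.enorm_eq_ofReal hx
  have hL1 : Tendsto (fun k => eLpNorm (f k - 0) 1 μ) atTop (𝓝 0) := by
    simp only [hnorm]
    simpa using ENNReal.tendsto_ofReal hlim
  obtain ⟨ns, hns, hae⟩ := (tendstoInMeasure_of_tendsto_eLpNorm one_ne_zero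
    (fun k => (hfi k).1) aestronglyMeasurable_zero hL1).exists_seq_tendsto_ae
  filter_upwards [hfg, hae] with x h₁ h₂
  exact tendsto_nhds_unique (h₁.comp hns.tendsto_atTop) h₂

theorem tendsto_eLpNorm_top_of_tendstoUniformlyOn {s : Set X} (hs : MeasurableSet s)
    {f : ℕ → X → F} {g : X → F} (h : TendstoUniformlyOn f g atTop s) :
    Tendsto (fun k => eLpNorm (f k - g) ⊤ (μ.restrict s)) atTop (𝓝 0) := by
  refine ENNReal.tendsto_nhds_zero.2 fun ε hε => ?_
  obtain ⟨δ, hδ, hδε⟩ := ENNReal.lt_iff_exists_nnreal_btwn.1 hε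
  filter_upwards [Metric.tendstoUniformlyOn_iff.1 h δ (by simpa using hδ)] with k hk
  refine le_trans ?_ hδε.le
  rw [eLpNorm_exponent_top]
  refine eLpNormEssSup_le_of_ae_nnnorm_bound ?_
  filter_upwards [ae_restrict_mem hs] with x hx
  simpa [dist_eq_norm, norm_sub_rev, ← NNReal.coe_le_coe] using (hk x hx).le

variable [NormedSpace ℝ F]

theorem enorm_integral_rpow_le_lintegral {ν : Measure Y} [IsProbabilityMeasure ν] {f : Y → F}
    (hf : AEStronglyMeasurable f ν) {p : ℝ} (hp : 1 ≤ p) :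
    ‖∫ y, f y ∂ν‖ₑ ^ p ≤ ∫⁻ y, ‖f y‖ₑ ^ p ∂ν := by
  have hp0 : 0 < p := one_pos.trans_le hp
  calc ‖∫ y, f y ∂ν‖ₑ ^ p ≤ (eLpNorm' f 1 ν) ^ p := by
        gcongr
        simpa [eLpNorm'] using enorm_integral_le_lintegral_enorm f
    _ ≤ (eLpNorm' f p ν) ^ p := by
        gcongr
        exact eLpNorm'_le_eLpNorm'_of_exponent_le one_pos hp ν hf
    _ = ∫⁻ y, ‖f y‖ₑ ^ p ∂ν := (lintegral_rpow_enorm_eq_rpow_eLpNorm' hp0).symm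

theorem eLpNorm_integral_le_of_ae_le [SFinite μ] {ν : Measure Y} [IsProbabilityMeasure ν]
    {f : X → Y → F} (hf : AEStronglyMeasurable (Function.uncurry f) (μ.prod ν)) {p : ℝ≥0∞}
    (hp : 1 ≤ p) (hp_top : p ≠ ⊤) {ε : ℝ≥0∞} (hε : ∀ᵐ y ∂ν, eLpNorm (f · y) p μ ≤ ε) :
    eLpNorm (fun x => ∫ y, f x y ∂ν) p μ ≤ ε := by
  have hp1 : 1 ≤ p.toReal := by simpa using ENNReal.toReal_mono hp_top hp
  have hp0 : 0 < p.toReal := one_pos.trans_le hp1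
  have hpow : ∀ g : X → F, ∫⁻ x, ‖g x‖ₑ ^ p.toReal ∂μ = eLpNorm g p μ ^ p.toReal := fun g => by
    rw [lintegral_rpow_enorm_eq_rpow_eLpNorm' hp0,
      eLpNorm_eq_eLpNorm' (one_pos.trans_le hp).ne' hp_top]
  rw [← ENNReal.rpow_le_rpow_iff hp0, ← hpow]
  calc ∫⁻ x, ‖∫ y, f x y ∂ν‖ₑ ^ p.toReal ∂μ
      ≤ ∫⁻ x, ∫⁻ y, ‖f x y‖ₑ ^ p.toReal ∂ν ∂μ := by
        refine lintegral_mono_ae ?_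
        filter_upwards [hf.prodMk_left] with x hx
        exact enorm_integral_rpow_le_lintegral hx hp1
    _ = ∫⁻ y, eLpNorm (f · y) p μ ^ p.toReal ∂ν := by
        rw [lintegral_lintegral_swap (hf.enorm.pow_const p.toReal)]
        simp only [← hpow]
    _ ≤ ∫⁻ _, ε ^ p.toReal ∂ν := by
        refine lintegral_mono_ae ?_
        filter_upwards [hε] with y hy
        gcongr
    _ = ε ^ p.toReal := by simp

theorem eLpNorm_bilin_le {F₁ F₂ : Type*} [NormedAddCommGroup F₁] [NormedSpace ℝ F₁]
    [NormedAddCommGroup F₂] [NormedSpace ℝ F₂] (B : F₁ →L[ℝ] F₂ →L[ℝ] F) {p q r : ℝ≥0∞}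
    [p.HolderTriple q r] {f : X → F₁} {g : X → F₂} (hf : AEStronglyMeasurable f μ)
    (hg : AEStronglyMeasurable g μ) :
    eLpNorm (fun x => B (f x) (g x)) r μ ≤ ‖B‖₊ * eLpNorm f p μ * eLpNorm g q μ :=
  eLpNorm_le_eLpNorm_mul_eLpNorm'_of_norm hf hg (B · ·) ‖B‖₊
    (.of_forall fun x => B.le_opNorm₂ (f x) (g x))

theorem tendsto_eLpNorm_bilin {F₁ F₂ : Type*} [NormedAddCommGroup F₁] [NormedSpace ℝ F₁]
    [NormedAddCommGroup F₂] [NormedSpace ℝ F₂] (B : F₁ →L[ℝ] F₂ →L[ℝ] F) {p q : ℝ≥0∞}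
    [p.HolderConjugate q] {f : ℕ → X → F₁} {f₀ : X → F₁} {g : ℕ → X → F₂} {g₀ : X → F₂}
    (hf : ∀ k, MemLp (f k) p μ) (hf₀ : MemLp f₀ p μ)
    (hf_lim : Tendsto (fun k => eLpNorm (f k - f₀) p μ) atTop (𝓝 0)) (hg : ∀ k, MemLp (g k) q μ)
    (hg₀ : MemLp g₀ q μ) (hg_lim : Tendsto (fun k => eLpNorm (g k - g₀) q μ) atTop (𝓝 0)) :
    Tendsto (fun k => eLpNorm ((fun x => B (f k x) (g k x)) - fun x => B (f₀ x) (g₀ x)) 1 μ)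
      atTop (𝓝 0) := by
  have hmem : ∀ {u : X → F₁} {v : X → F₂}, MemLp u p μ → MemLp v q μ →
      AEStronglyMeasurable (fun x => B (u x) (v x)) μ := fun hu hv => (B.memLp_of_bilin 1 hu hv).1
  have hbound : Tendsto (fun k => ‖B‖₊ * eLpNorm (f k - f₀) p μ * eLpNorm (g k - g₀) q μ +
      ‖B‖₊ * eLpNorm (f k - f₀) p μ * eLpNorm g₀ q μ +
      ‖B‖₊ * eLpNorm f₀ p μ * eLpNorm (g k - g₀) q μ) atTop (𝓝 0) := by
    have hF := ENNReal.Tendsto.const_mul hf_lim (.inr (ENNReal.coe_ne_top (r := ‖B‖₊)))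
    have h₁ := ENNReal.Tendsto.mul hF (by simp) hg_lim (by simp)
    have h₂ := ENNReal.Tendsto.mul_const hF (.inr hg₀.2.ne)
    have h₃ := ENNReal.Tendsto.const_mul hg_lim
      (.inr (ENNReal.mul_ne_top (ENNReal.coe_ne_top (r := ‖B‖₊)) hf₀.2.ne))
    simpa using (h₁.add h₂).add h₃
  refine tendsto_of_tendsto_of_tendsto_of_le_of_le tendsto_const_nhds hbound
    (fun k => zero_le) fun k => ?_
  have hsplit : (fun x => B (f k x) (g k x)) - (fun x => B (f₀ x) (g₀ x)) =
      (fun x => B ((f k - f₀) x) ((g k - g₀) x)) + (fun x => B ((f k - f₀) x) (g₀ x)) +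
        fun x => B (f₀ x) ((g k - g₀) x) := by
    ext x
    simp only [Pi.sub_apply, Pi.add_apply, map_sub, sub_apply]
    abel
  have hdf := (hf k).sub hf₀
  have hdg := (hg k).sub hg₀
  rw [hsplit]
  refine (eLpNorm_add_le ((hmem hdf hdg).add (hmem hdf hg₀)) (hmem hf₀ hdg) le_rfl).trans ?_
  refine add_le_add ((eLpNorm_add_le (hmem hdf hdg) (hmem hdf hg₀) le_rfl).trans ?_) ?_
  · exact add_le_add (eLpNorm_bilin_le B hdf.1 hdg.1) (eLpNorm_bilin_le B hdf.1 hg₀.1)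
  · exact eLpNorm_bilin_le B hf₀.1 hdg.1

theorem tendsto_integral_bilin {F₁ F₂ : Type*} [NormedAddCommGroup F₁] [NormedSpace ℝ F₁]
    [NormedAddCommGroup F₂] [NormedSpace ℝ F₂] (B : F₁ →L[ℝ] F₂ →L[ℝ] F) {p q : ℝ≥0∞}
    [p.HolderConjugate q] {f : ℕ → X → F₁} {f₀ : X → F₁} {g : ℕ → X → F₂} {g₀ : X → F₂}
    (hf : ∀ k, MemLp (f k) p μ) (hf₀ : MemLp f₀ p μ)
    (hf_lim : Tendsto (fun k => eLpNorm (f k - f₀) p μ) atTop (𝓝 0)) (hg : ∀ k, MemLp (g k) q μ)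
    (hg₀ : MemLp g₀ q μ) (hg_lim : Tendsto (fun k => eLpNorm (g k - g₀) q μ) atTop (𝓝 0)) :
    Tendsto (fun k => ∫ x, B (f k x) (g k x) ∂μ) atTop (𝓝 (∫ x, B (f₀ x) (g₀ x) ∂μ)) :=
  tendsto_integral_of_L1' _ (B.memLp_of_bilin 1 hf₀ hg₀).1
    (.of_forall fun k => memLp_one_iff_integrable.1 (B.memLp_of_bilin 1 (hf k) (hg k)))
    (tendsto_eLpNorm_bilin B hf hf₀ hf_lim hg hg₀ hg_lim)

end Measure

section Mollification

open scoped ENNReal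

variable {E F : Type*} [NormedAddCommGroup E] [NormedSpace ℝ E] [FiniteDimensional ℝ E]
  [MeasurableSpace E] [BorelSpace E] [NormedAddCommGroup F] {μ : Measure E} [μ.IsAddHaarMeasure]

theorem tendsto_eLpNorm_translate_sub {p : ℝ≥0∞} (hp : 1 ≤ p) (hp_top : p ≠ ⊤) {g : E → F}
    (hg : MemLp g p μ) :
    Tendsto (fun t => eLpNorm (fun x => g (x - t) - g x) p μ) (𝓝 0) (𝓝 0) := by
  have : Fact (1 ≤ p) := ⟨hp⟩
  let translate : C(E, C(E, E)) := ContinuousMap.curry ⟨fun z : E × E => z.2 - z.1, by fun_prop⟩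
  have hpres : ∀ t : E, MeasurePreserving (translate t) μ μ := measurePreserving_sub_right μ
  have hcont := (continuous_const (y := hg.toLp g)).compMeasurePreservingLp translate.continuous
    hpres hp_top |>.tendsto 0
  rw [tendsto_iff_edist_tendsto_0] at hcont
  refine hcont.congr fun t => ?_
  simp_rw [Lp.toLp_compMeasurePreserving, Lp.edist_toLp_toLp]
  congr 1 with x
  simp [translate]

variable [NormedSpace ℝ F] [CompleteSpace F]

theorem normed_convolution_sub_eq_integral (φ : ContDiffBump (0 : E)) {g : E → F}
    (hg : LocallyIntegrable g μ) (x : E) :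
    (φ.normed μ ⋆[ContinuousLinearMap.lsmul ℝ ℝ, μ] g - g) x =
      ∫ t, (g (x - t) - g x) ∂μ.withDensity (fun t => ENNReal.ofReal (φ.normed μ t)) := by
  have hconv : Integrable (fun t => φ.normed μ t • g (x - t)) μ :=
    φ.hasCompactSupport_normed.convolutionExists_left (ContinuousLinearMap.lsmul ℝ ℝ)
      φ.continuous_normed hg x
  rw [integral_withDensity_eq_integral_toReal_smul
    φ.continuous_normed.measurable.ennreal_ofReal (by simp)]
  simp only [ENNReal.toReal_ofReal (φ.nonneg_normed _), smul_sub]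
  rw [integral_sub hconv (φ.integrable_normed.smul_const _), integral_smul_const, φ.integral_normed,
    one_smul]
  rfl

theorem eLpNorm_normed_convolution_sub_le (φ : ContDiffBump (0 : E)) {p : ℝ≥0∞} (hp : 1 ≤ p)
    (hp_top : p ≠ ⊤) {g : E → F} (hg : MemLp g p μ) {ε : ℝ≥0∞}
    (hε : ∀ t ∈ ball (0 : E) φ.rOut, eLpNorm (fun x => g (x - t) - g x) p μ ≤ ε) :
    eLpNorm (φ.normed μ ⋆[ContinuousLinearMap.lsmul ℝ ℝ, μ] g - g) p μ ≤ ε := by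
  have hρ : Measurable (fun t => ENNReal.ofReal (φ.normed μ t)) :=
    φ.continuous_normed.measurable.ennreal_ofReal
  set ν := μ.withDensity (fun t => ENNReal.ofReal (φ.normed μ t)) with hν
  have hprob : IsProbabilityMeasure ν := ⟨by
    rw [hν, withDensity_apply _ .univ, setLIntegral_univ,
      ← ofReal_integral_eq_lintegral_ofReal φ.integrable_normed (.of_forall φ.nonneg_normed),
      φ.integral_normed, ENNReal.ofReal_one]⟩
  rw [funext (normed_convolution_sub_eq_integral φ (hg.locallyIntegrable hp))]
  refine eLpNorm_integral_le_of_ae_le ?_ hp hp_top ?_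
  · refine AEStronglyMeasurable.mono_ac
      (Measure.AbsolutelyContinuous.rfl.prod (withDensity_absolutelyContinuous μ _)) ?_
    exact (hg.1.comp_quasiMeasurePreserving
      (quasiMeasurePreserving_sub_of_right_invariant μ μ)).sub hg.1.comp_fst
  · refine (ae_withDensity_iff hρ).2 (.of_forall fun t ht => hε t ?_)
    rw [← φ.support_normed_eq (μ := μ)]
    exact fun h => ht (by simp [h])

theorem tendsto_eLpNorm_normed_convolution_sub {φ : ℕ → ContDiffBump (0 : E)}
    (hφ : Tendsto (fun k => (φ k).rOut) atTop (𝓝 0)) {p : ℝ≥0∞} (hp : 1 ≤ p) (hp_top : p ≠ ⊤)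
    {g : E → F} (hg : MemLp g p μ) :
    Tendsto (fun k => eLpNorm ((φ k).normed μ ⋆[ContinuousLinearMap.lsmul ℝ ℝ, μ] g - g) p μ)
      atTop (𝓝 0) := by
  refine ENNReal.tendsto_nhds_zero.2 fun ε hε => ?_
  obtain ⟨r, hr, hball⟩ := Metric.eventually_nhds_iff_ball.1
    ((tendsto_eLpNorm_translate_sub hp hp_top hg).eventually_le_const hε)
  filter_upwards [hφ.eventually_lt_const hr] with k hk
  exact eLpNorm_normed_convolution_sub_le (φ k) hp hp_top hg fun t ht =>
    hball t (ball_subset_ball hk.le ht)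

theorem tendstoUniformlyOn_normed_convolution {φ : ℕ → ContDiffBump (0 : E)}
    (hφ : Tendsto (fun k => (φ k).rOut) atTop (𝓝 0)) {g : E → F} (hg : AEStronglyMeasurable g μ)
    {C : Set E} {δ : ℝ} (hδ : 0 < δ) (hgC : UniformContinuousOn g (thickening δ C)) :
    TendstoUniformlyOn (fun k => (φ k).normed μ ⋆[ContinuousLinearMap.lsmul ℝ ℝ, μ] g) g
      atTop C := by
  refine Metric.tendstoUniformlyOn_iff.2 fun ε hε => ?_
  obtain ⟨r, hr, hgr⟩ := Metric.uniformContinuousOn_iff.1 hgC (ε / 2) (half_pos hε)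
  filter_upwards [hφ.eventually_lt_const hr, hφ.eventually_lt_const hδ] with k hkr hkδ x hx
  rw [dist_comm]
  refine ((φ k).dist_normed_convolution_le hg fun y hy => ?_).trans_lt (half_lt_self hε)
  exact (hgr y (mem_thickening_iff.2 ⟨x, hx, (mem_ball.1 hy).trans hkδ⟩) x
    (self_subset_thickening hδ C hx) ((mem_ball.1 hy).trans hkr)).le

end Mollification

section Gradient

variable {E : Type*} [NormedAddCommGroup E] [InnerProductSpace ℝ E] [CompleteSpace E]
  {f g : E → ℝ} {x : E}

theorem norm_gradient (f : E → ℝ) (x : E) : ‖∇ f x‖ = ‖fderiv ℝ f x‖ := by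
  rw [← toDual_gradient, LinearIsometryEquiv.norm_map]

theorem continuous_gradient (hf : ContDiff ℝ 1 f) : Continuous (∇ f) :=
  (InnerProductSpace.toDual ℝ E).symm.continuous.comp (hf.continuous_fderiv one_ne_zero)

theorem tsupport_gradient_subset (f : E → ℝ) : tsupport (∇ f) ⊆ tsupport f := by
  refine closure_minimal (fun x hx => support_fderiv_subset ℝ fun hfx => hx ?_)
    (isClosed_tsupport f)
  rw [← norm_eq_zero, norm_gradient, hfx, norm_zero]

theorem gradient_eq_zero_of_notMem_tsupport (hx : x ∉ tsupport f) : ∇ f x = 0 :=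
  image_eq_zero_of_notMem_tsupport fun h => hx (tsupport_gradient_subset f h)

theorem gradient_fun_sub (hf : DifferentiableAt ℝ f x) (hg : DifferentiableAt ℝ g x) :
    ∇ (fun y => f y - g y) x = ∇ f x - ∇ g x :=
  ext_inner_right ℝ fun e => by
    simp only [inner_gradient_left, fderiv_fun_sub hf hg, inner_sub_left, sub_apply]

theorem gradient_fun_mul (hf : DifferentiableAt ℝ f x) (hg : DifferentiableAt ℝ g x) :
    ∇ (fun y => f y * g y) x = f x • ∇ g x + g x • ∇ f x :=
  ext_inner_right ℝ fun e => by
    simp only [inner_gradient_left, fderiv_fun_mul hf hg, inner_add_left, real_inner_smul_left,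
      add_apply, smul_apply, smul_eq_mul]

theorem gradient_fun_comp {h : ℝ → ℝ} (hh : DifferentiableAt ℝ h (f x))
    (hf : DifferentiableAt ℝ f x) : ∇ (fun y => h (f y)) x = deriv h (f x) • ∇ f x :=
  ext_inner_right ℝ fun e => by
    rw [inner_gradient_left, fderiv_fun_comp x hh hf, real_inner_smul_left, inner_gradient_left,
      ContinuousLinearMap.comp_apply, fderiv_eq_deriv_mul]

theorem gradient_comp_const_sub {a : E} (hf : DifferentiableAt ℝ f (a - x)) :
    ∇ (fun t => f (a - t)) x = -∇ f (a - x) :=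
  ext_inner_right ℝ fun e => by
    have hd := hf.hasFDerivAt.comp x ((hasFDerivAt_id x).const_sub a)
    rw [inner_gradient_left, inner_neg_left, inner_gradient_left, ← Function.comp_def f, hd.fderiv]
    simp

theorem gradient_convolution [MeasurableSpace E] [BorelSpace E] [FiniteDimensional ℝ E]
    {μ : Measure E} [μ.IsAddHaarMeasure] (hf : ContDiff ℝ 1 f) (hfc : HasCompactSupport f)
    (hg : LocallyIntegrable g μ) (x : E) :
    ∇ (f ⋆[ContinuousLinearMap.lsmul ℝ ℝ, μ] g) x = ∫ t, g t • ∇ f (x - t) ∂μ := by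
  have hsmul : Integrable (fun t => g t • ∇ f (x - t)) μ :=
    hg.integrable_smul_right_of_hasCompactSupport
      ((continuous_gradient hf).comp (continuous_const.sub continuous_id))
      ((hfc.mono' ((subset_tsupport _).trans (tsupport_gradient_subset f))).comp_homeomorph
        (Homeomorph.subLeft x))
  refine ext_inner_left ℝ fun e => ?_
  rw [inner_gradient_right, (hfc.hasFDerivAt_convolution_left _ hf hg x).fderiv, conj_trivial,
    ← integral_inner hsmul, convolution_eq_swap, ContinuousLinearMap.integral_apply]
  swap
  · exact ((hfc.fderiv ℝ).convolutionExists_left _ (hf.continuous_fderiv one_ne_zero)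
      hg x).integrable_swap
  refine integral_congr_ae (.of_forall fun t => ?_)
  simp only [ContinuousLinearMap.precompL_apply, ContinuousLinearMap.lsmul_apply,
    real_inner_smul_right, inner_gradient_right, conj_trivial, smul_eq_mul, mul_comm]

end Gradient

section WeakGradient

variable {n : ℕ} {Ω Ω' : Set (EuclideanSpace ℝ (Fin n))}

local notation "𝔼" => EuclideanSpace ℝ (Fin n)

theorem IsTestFunction.mono {φ : 𝔼 → ℝ} (hφ : IsTestFunction Ω φ) (h : Ω ⊆ Ω') :
    IsTestFunction Ω' φ :=
  ⟨hφ.smooth, hφ.compact_support, hφ.support_subset.trans h⟩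

theorem IsTestFunction.continuous_gradient {φ : 𝔼 → ℝ} (hφ : IsTestFunction Ω φ) :
    Continuous (∇ φ) :=
  ExteriorComparison.continuous_gradient (hφ.smooth.of_le (by simp))

theorem IsTestFunction.hasCompactSupport_gradient {φ : 𝔼 → ℝ} (hφ : IsTestFunction Ω φ) :
    HasCompactSupport (∇ φ) :=
  hφ.compact_support.mono' ((subset_tsupport _).trans (tsupport_gradient_subset φ))

theorem IsTestFunction.tsupport_gradient_subset {φ : 𝔼 → ℝ} (hφ : IsTestFunction Ω φ) :
    tsupport (∇ φ) ⊆ Ω :=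
  (ExteriorComparison.tsupport_gradient_subset φ).trans hφ.support_subset

theorem setIntegral_eq_integral_of_tsupport_subset {F₁ F : Type*} [NormedAddCommGroup F₁]
    [NormedAddCommGroup F] [NormedSpace ℝ F] {Φ : 𝔼 → F₁} (hΦ : tsupport Φ ⊆ Ω) {f : 𝔼 → F}
    (hf : ∀ x, Φ x = 0 → f x = 0) : ∫ x in Ω, f x = ∫ x, f x :=
  setIntegral_eq_integral_of_forall_compl_eq_zero fun x hx =>
    hf x (image_eq_zero_of_notMem_tsupport fun h => hx (hΦ h))

theorem integrable_bilin_of_hasCompactSupport {F₁ F₂ F : Type*} [NormedAddCommGroup F₁]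
    [NormedSpace ℝ F₁] [NormedAddCommGroup F₂] [NormedSpace ℝ F₂] [NormedAddCommGroup F]
    [NormedSpace ℝ F] (B : F₁ →L[ℝ] F₂ →L[ℝ] F) {Φ : 𝔼 → F₁} (hΦ : Continuous Φ)
    (hΦc : HasCompactSupport Φ) (hΦΩ : tsupport Φ ⊆ Ω) {g : 𝔼 → F₂}
    (hg : LocallyIntegrableOn g Ω volume) : Integrable (fun x => B (Φ x) (g x)) volume := by
  obtain ⟨M, hM⟩ := hΦ.bounded_above_of_compact_support hΦc
  refine IntegrableOn.integrable_of_forall_notMem_eq_zero (s := tsupport Φ)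
    (B.integrable_of_bilin_of_bdd_left M
      (hΦ.stronglyMeasurable_of_hasCompactSupport hΦc).aestronglyMeasurable (.of_forall hM)
      (hg.integrableOn_compact_subset hΦΩ hΦc)) fun x hx => ?_
  rw [image_eq_zero_of_notMem_tsupport hx, map_zero, zero_apply]

theorem MemLpLoc.congr_ae {F : Type*} [NormedAddCommGroup F] {p : ℝ} {G H : 𝔼 → F}
    (hG : MemLpLoc Ω p G) (h : G =ᵐ[volume.restrict Ω] H) : MemLpLoc Ω p H :=
  fun C hC hCΩ => (hG C hC hCΩ).ae_eq (ae_restrict_of_ae_restrict_of_subset hCΩ h)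

theorem memLp_restrict_of_continuousOn {F : Type*} [NormedAddCommGroup F] (p : ENNReal)
    {C : Set 𝔼} (hC : IsCompact C) {g : 𝔼 → F} (hg : ContinuousOn g C) :
    MemLp g p (volume.restrict C) := by
  have : IsFiniteMeasure ((volume : Measure 𝔼).restrict C) :=
    isFiniteMeasure_restrict.2 hC.measure_ne_top
  obtain ⟨M, hM⟩ := hC.exists_bound_of_continuousOn hg
  exact .of_bound (hg.aestronglyMeasurable hC.measurableSet) M
    (ae_restrict_of_forall_mem hC.measurableSet hM)

namespace HasWeakGradient

variable {u v φ : EuclideanSpace ℝ (Fin n) → ℝ}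
  {G H : EuclideanSpace ℝ (Fin n) → EuclideanSpace ℝ (Fin n)}

theorem integrable_smul_gradient (hu : HasWeakGradient Ω u G) (hφ : IsTestFunction Ω φ) :
    Integrable (fun x => u x • ∇ φ x) volume :=
  integrable_bilin_of_hasCompactSupport (ContinuousLinearMap.lsmul ℝ ℝ).flip
    hφ.continuous_gradient hφ.hasCompactSupport_gradient hφ.tsupport_gradient_subset
    hu.locallyIntegrable

theorem integrable_smul (hu : HasWeakGradient Ω u G) (hφ : IsTestFunction Ω φ) :
    Integrable (fun x => φ x • G x) volume :=
  integrable_bilin_of_hasCompactSupport (ContinuousLinearMap.lsmul ℝ ℝ) hφ.smooth.continuous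
    hφ.compact_support hφ.support_subset hu.locallyIntegrable_grad

theorem integral_smul_gradient_eq_neg (hu : HasWeakGradient Ω u G) (hφ : IsTestFunction Ω φ) :
    ∫ x, u x • ∇ φ x = -∫ x, φ x • G x := by
  rw [← setIntegral_eq_integral_of_tsupport_subset hφ.tsupport_gradient_subset
      (by simp +contextual), hu.integral_eq φ hφ,
    setIntegral_eq_integral_of_tsupport_subset hφ.support_subset (by simp +contextual)]

theorem of_integral_smul_gradient_eq_neg (hu : LocallyIntegrableOn u Ω volume)
    (hG : LocallyIntegrableOn G Ω volume)
    (h : ∀ φ, IsTestFunction Ω φ → ∫ x, u x • ∇ φ x = -∫ x, φ x • G x) :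
    HasWeakGradient Ω u G where
  locallyIntegrable := hu
  locallyIntegrable_grad := hG
  integral_eq φ hφ := by
    rw [setIntegral_eq_integral_of_tsupport_subset hφ.tsupport_gradient_subset
      (by simp +contextual), h φ hφ,
      setIntegral_eq_integral_of_tsupport_subset hφ.support_subset (by simp +contextual)]

theorem sub (hu : HasWeakGradient Ω u G) (hv : HasWeakGradient Ω v H) :
    HasWeakGradient Ω (fun x => u x - v x) (fun x => G x - H x) :=
  of_integral_smul_gradient_eq_neg (hu.locallyIntegrable.sub hv.locallyIntegrable)
    (hu.locallyIntegrable_grad.sub hv.locallyIntegrable_grad) fun φ hφ => by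
      simp only [sub_smul, smul_sub]
      rw [integral_sub (hu.integrable_smul_gradient hφ) (hv.integrable_smul_gradient hφ),
        integral_sub (hu.integrable_smul hφ) (hv.integrable_smul hφ),
        hu.integral_smul_gradient_eq_neg hφ, hv.integral_smul_gradient_eq_neg hφ, neg_sub_neg,
        neg_sub]

theorem ae_eq (hΩ : IsOpen Ω) (hG : HasWeakGradient Ω u G) (hH : HasWeakGradient Ω u H) :
    G =ᵐ[volume.restrict Ω] H := by
  have key := hΩ.ae_eq_zero_of_integral_contDiff_smul_eq_zero (μ := volume)
    (hG.locallyIntegrable_grad.sub hH.locallyIntegrable_grad) fun φ hφ hφc hφΩ => by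
      simpa using ((hG.sub hH).integral_smul_gradient_eq_neg ⟨hφ, hφc, hφΩ⟩).symm
  rw [EventuallyEq, ae_restrict_iff' hΩ.measurableSet]
  filter_upwards [key] with x hx hxΩ using sub_eq_zero.1 (hx hxΩ)

theorem mono (hu : HasWeakGradient Ω u G) (h : Ω' ⊆ Ω) : HasWeakGradient Ω' u G :=
  of_integral_smul_gradient_eq_neg (hu.locallyIntegrable.mono_set h)
    (hu.locallyIntegrable_grad.mono_set h) fun _ hφ =>
      hu.integral_smul_gradient_eq_neg (hφ.mono h)

theorem congr (hΩ : MeasurableSet Ω) (hu : HasWeakGradient Ω u G) (huv : EqOn u v Ω)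
    (hGH : EqOn G H Ω) : HasWeakGradient Ω v H where
  locallyIntegrable := hu.locallyIntegrable.congr (ae_restrict_of_forall_mem hΩ huv)
  locallyIntegrable_grad := hu.locallyIntegrable_grad.congr (ae_restrict_of_forall_mem hΩ hGH)
  integral_eq φ hφ := by
    rw [← setIntegral_congr_fun hΩ fun x hx => congrArg (· • ∇ φ x) (huv hx), hu.integral_eq φ hφ,
      setIntegral_congr_fun hΩ fun x hx => congrArg (φ x • ·) (hGH hx)]

end HasWeakGradient

theorem hasWeakGradient_gradient {f : 𝔼 → ℝ} (hf : ContDiff ℝ 1 f) :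
    HasWeakGradient Ω f (∇ f) := by
  have hloc := (continuous_gradient hf).locallyIntegrable (μ := volume)
  refine .of_integral_smul_gradient_eq_neg
    (hf.continuous.locallyIntegrable.locallyIntegrableOn _) (hloc.locallyIntegrableOn _)
    fun φ hφ => ext_inner_left ℝ fun (e : 𝔼) => ?_
  have hw : Integrable (fun x => f x • ∇ φ x) volume :=
    integrable_bilin_of_hasCompactSupport (ContinuousLinearMap.lsmul ℝ ℝ).flip
      hφ.continuous_gradient hφ.hasCompactSupport_gradient (subset_univ _)
      (hf.continuous.locallyIntegrable.locallyIntegrableOn _)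
  have hg : Integrable (fun x => φ x • ∇ f x) volume :=
    integrable_bilin_of_hasCompactSupport (ContinuousLinearMap.lsmul ℝ ℝ) hφ.smooth.continuous
      hφ.compact_support (subset_univ _) (hloc.locallyIntegrableOn _)
  have hprod : Integrable (fun x => f x * φ x) volume :=
    (hf.continuous.mul hφ.smooth.continuous).integrable_of_hasCompactSupport
      hφ.compact_support.mul_left
  rw [inner_neg_right, ← integral_inner hw, ← integral_inner hg]
  have hw' := hw.const_inner (𝕜 := ℝ) e
  have hg' := hg.const_inner (𝕜 := ℝ) e
  simp only [real_inner_smul_right, inner_gradient_right, conj_trivial] at hw' hg' ⊢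
  rw [integral_mul_fderiv_eq_neg_fderiv_mul_of_integrable (by simpa only [mul_comm] using hg')
    hw' hprod (fun x _ => hf.differentiable one_ne_zero x)
    (fun x _ => hφ.smooth.differentiable (by simp) x)]
  simp only [mul_comm]

theorem HasWeakGradient.gradient_convolution {w : 𝔼 → ℝ} {G : 𝔼 → 𝔼} (hw : HasWeakGradient Ω w G)
    (hwi : LocallyIntegrable w volume) {ρ : 𝔼 → ℝ} (hρ : ContDiff ℝ ∞ ρ)
    (hρc : HasCompactSupport ρ) {x : 𝔼} (hx : tsupport (fun t => ρ (x - t)) ⊆ Ω) :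
    ∇ (ρ ⋆[ContinuousLinearMap.lsmul ℝ ℝ, volume] w) x =
      (ρ ⋆[ContinuousLinearMap.lsmul ℝ ℝ, volume] G) x := by
  have hρx : IsTestFunction Ω (fun t => ρ (x - t)) :=
    ⟨hρ.comp (contDiff_const.sub contDiff_id), hρc.comp_homeomorph (Homeomorph.subLeft x), hx⟩
  have hgrad : ∀ t, ∇ (fun t => ρ (x - t)) t = -∇ ρ (x - t) := fun t =>
    gradient_comp_const_sub (hρ.differentiable (by simp) _)
  rw [ExteriorComparison.gradient_convolution (hρ.of_le (by simp)) hρc hwi,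
    convolution_lsmul_swap, ← neg_neg (∫ t, ρ (x - t) • G t),
    ← hw.integral_smul_gradient_eq_neg hρx, ← integral_neg]
  simp only [hgrad, smul_neg, neg_neg]

theorem tsupport_normed_comp_const_sub (φ : ContDiffBump (0 : 𝔼)) (x : 𝔼) :
    tsupport (fun t => φ.normed volume (x - t)) = closedBall x φ.rOut := by
  refine (tsupport_comp_eq_preimage (φ.normed (volume : Measure 𝔼))
    (Homeomorph.subLeft x)).trans ?_
  rw [φ.tsupport_normed_eq]
  ext t
  simp [dist_comm, dist_eq_norm]

theorem HasWeakGradient.exists_smooth_approx (hΩ : IsOpen Ω) {p : ℝ} (hp : 1 ≤ p) {w : 𝔼 → ℝ}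
    {G : 𝔼 → 𝔼} (hw : ContinuousOn w Ω) (hG : HasWeakGradient Ω w G) (hGp : MemLpLoc Ω p G)
    {C : Set 𝔼} (hC : IsCompact C) (hCΩ : C ⊆ Ω) :
    ∃ W : ℕ → 𝔼 → ℝ, (∀ k, ContDiff ℝ ∞ (W k)) ∧ TendstoUniformlyOn W w atTop C ∧
      Tendsto (fun k => eLpNorm (∇ (W k) - G) (ENNReal.ofReal p) (volume.restrict C)) atTop
        (𝓝 0) := by
  obtain ⟨δ, hδ, hδΩ⟩ := hC.exists_cthickening_subset_open hΩ hCΩ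
  set S := cthickening δ C
  have hS : IsCompact S := hC.cthickening
  have hCS : C ⊆ S := self_subset_cthickening C
  have hwS : Integrable (S.indicator w) volume :=
    (hG.locallyIntegrable.integrableOn_compact_subset hδΩ hS).integrable_indicator
      hS.measurableSet
  have hGS : MemLp (S.indicator G) (ENNReal.ofReal p) volume :=
    (memLp_indicator_iff_restrict hS.measurableSet).2 (hGp S hS hδΩ)
  have hweak : HasWeakGradient (thickening δ C) (S.indicator w) (S.indicator G) :=
    (hG.mono ((thickening_subset_cthickening δ C).trans hδΩ)).congr
      isOpen_thickening.measurableSet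
      ((eqOn_indicator.mono (thickening_subset_cthickening δ C)).symm)
      ((eqOn_indicator.mono (thickening_subset_cthickening δ C)).symm)
  let φ : ℕ → ContDiffBump (0 : 𝔼) := fun k =>
    ⟨δ / (k + 2) / 2, δ / (k + 2), by positivity, half_lt_self (by positivity)⟩
  have hφδ : ∀ k, (φ k).rOut < δ := fun k => div_lt_self hδ (by linarith [k.cast_nonneg (α := ℝ)])
  have hφ0 : Tendsto (fun k => (φ k).rOut) atTop (𝓝 0) :=
    ((tendsto_natCast_atTop_atTop.atTop_add tendsto_const_nhds).const_div_atTop δ)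
  refine ⟨fun k => (φ k).normed volume ⋆[ContinuousLinearMap.lsmul ℝ ℝ, volume] S.indicator w,
    fun k => (φ k).hasCompactSupport_normed.contDiff_convolution_left _ (φ k).contDiff_normed
      hwS.locallyIntegrable, ?_, ?_⟩
  · refine (tendstoUniformlyOn_normed_convolution hφ0 hwS.aestronglyMeasurable hδ ?_).congr_right
      (eqOn_indicator.mono hCS)
    exact ((hS.uniformContinuousOn_of_continuous (hw.mono hδΩ)).congr eqOn_indicator.symm).mono
      (thickening_subset_cthickening δ C)
  · refine tendsto_of_tendsto_of_tendsto_of_le_of_le tendsto_const_nhds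
      (tendsto_eLpNorm_normed_convolution_sub hφ0 (by simpa using hp) ENNReal.ofReal_ne_top hGS)
      (fun k => bot_le) fun k => le_trans (eLpNorm_congr_ae ?_).le
        (eLpNorm_mono_measure _ Measure.restrict_le_self)
    refine ae_restrict_of_forall_mem hC.measurableSet fun x hx => ?_
    rw [Pi.sub_apply, Pi.sub_apply, hweak.gradient_convolution hwS.locallyIntegrable
      (φ k).contDiff_normed (φ k).hasCompactSupport_normed, indicator_of_mem (hCS hx)]
    rw [tsupport_normed_comp_const_sub]
    exact (closedBall_subset_ball (hφδ k)).trans (ball_subset_thickening hx δ)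

theorem tendstoUniformlyOn_continuous_comp {X ι : Type*} [TopologicalSpace X] {l : Filter ι}
    {C : Set X} (hC : IsCompact C) {W : ι → X → ℝ} {w : X → ℝ} (hw : ContinuousOn w C)
    (hW : TendstoUniformlyOn W w l C) {h : ℝ → ℝ} (hh : Continuous h) :
    TendstoUniformlyOn (fun k x => h (W k x)) (fun x => h (w x)) l C := by
  have hwC : IsCompact (w '' C) := hC.image_of_continuousOn hw
  refine UniformContinuousOn.comp_tendstoUniformlyOn_eventually (s := cthickening 1 (w '' C)) ?_
    (fun x hx => self_subset_cthickening _ (mem_image_of_mem w hx))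
    (hwC.cthickening.uniformContinuousOn_of_continuous hh.continuousOn) hW
  filter_upwards [Metric.tendstoUniformlyOn_iff.1 hW 1 one_pos] with k hk x hx
  exact mem_cthickening_of_dist_le _ _ _ _ (mem_image_of_mem w hx)
    (dist_comm (w x) _ ▸ (hk x hx).le)

end WeakGradient

section SobolevCalculus

variable {n : ℕ} {Ω : Set (EuclideanSpace ℝ (Fin n))}

local notation "𝔼" => EuclideanSpace ℝ (Fin n)

theorem tendsto_setIntegral_smul_of_tendstoUniformlyOn {F : Type*} [NormedAddCommGroup F]
    [NormedSpace ℝ F] {C : Set 𝔼} (hC : IsCompact C) {W : ℕ → 𝔼 → ℝ} {w : 𝔼 → ℝ}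
    (hW : ∀ k, ContinuousOn (W k) C) (hWw : TendstoUniformlyOn W w atTop C) {g : 𝔼 → F}
    (hg : IntegrableOn g C volume) :
    Tendsto (fun k => ∫ x in C, W k x • g x) atTop (𝓝 (∫ x in C, w x • g x)) :=
  tendsto_integral_bilin (ContinuousLinearMap.lsmul ℝ ℝ) (p := ⊤) (q := 1)
    (fun k => memLp_restrict_of_continuousOn ⊤ hC (hW k))
    (memLp_restrict_of_continuousOn ⊤ hC (hWw.continuousOn (.of_forall hW)))
    (tendsto_eLpNorm_top_of_tendstoUniformlyOn hC.measurableSet hWw)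
    (fun _ => memLp_one_iff_integrable.2 hg) (memLp_one_iff_integrable.2 hg) (by simp)

theorem HasWeakGradient.memLpLoc_one {w : 𝔼 → ℝ} {G : 𝔼 → 𝔼} (hG : HasWeakGradient Ω w G) :
    MemLpLoc Ω 1 G := fun C hC hCΩ => by
  rw [ENNReal.ofReal_one, memLp_one_iff_integrable]
  exact hG.locallyIntegrable_grad.integrableOn_compact_subset hCΩ hC

theorem HasWeakGradient.of_approx (hΩ : MeasurableSet Ω) {w : 𝔼 → ℝ} {G : 𝔼 → 𝔼}
    (hw : ContinuousOn w Ω) (hG : LocallyIntegrableOn G Ω volume)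
    (happrox : ∀ C, IsCompact C → C ⊆ Ω → ∃ W : ℕ → 𝔼 → ℝ, (∀ k, ContDiff ℝ 1 (W k)) ∧
      TendstoUniformlyOn W w atTop C ∧
      Tendsto (fun k => eLpNorm (∇ (W k) - G) 1 (volume.restrict C)) atTop (𝓝 0)) :
    HasWeakGradient Ω w G := by
  refine .of_integral_smul_gradient_eq_neg (hw.locallyIntegrableOn hΩ) hG fun φ hφ => ?_
  have hC : IsCompact (tsupport φ) := hφ.compact_support
  obtain ⟨W, hW, hWw, hWG⟩ := happrox _ hC hφ.support_subset
  have hsupp : ∀ (v : 𝔼 → ℝ) (H : 𝔼 → 𝔼), (∫ x in tsupport φ, v x • ∇ φ x = ∫ x, v x • ∇ φ x) ∧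
      ∫ x in tsupport φ, φ x • H x = ∫ x, φ x • H x := fun v H =>
    ⟨setIntegral_eq_integral_of_tsupport_subset (tsupport_gradient_subset φ) (by simp +contextual),
      setIntegral_eq_integral_of_tsupport_subset (Φ := φ) subset_rfl (by simp +contextual)⟩
  have hleft := tendsto_setIntegral_smul_of_tendstoUniformlyOn hC
    (fun k => (hW k).continuous.continuousOn) hWw
    (hφ.continuous_gradient.integrable_of_hasCompactSupport (μ := volume)
      hφ.hasCompactSupport_gradient).integrableOn
  have hφC := memLp_restrict_of_continuousOn ⊤ hC hφ.smooth.continuous.continuousOn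
  have hright := tendsto_integral_bilin (ContinuousLinearMap.lsmul ℝ ℝ) (p := ⊤) (q := 1)
    (fun _ => hφC) hφC (by simp)
    (fun k => memLp_restrict_of_continuousOn 1 hC (continuous_gradient (hW k)).continuousOn)
    (memLp_one_iff_integrable.2 (hG.integrableOn_compact_subset hφ.support_subset hC)) hWG
  rw [← (hsupp w G).1, ← (hsupp w G).2]
  refine tendsto_nhds_unique hleft (hright.neg.congr fun k => ?_)
  have := (hasWeakGradient_gradient (hW k)).integral_smul_gradient_eq_neg hφ
  rw [← (hsupp _ (∇ (W k))).1, ← (hsupp (W k) _).2] at this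
  exact this.symm

theorem HasWeakGradient.comp (hΩ : IsOpen Ω) {w : 𝔼 → ℝ} {G : 𝔼 → 𝔼} (hw : ContinuousOn w Ω)
    (hG : HasWeakGradient Ω w G) {h : ℝ → ℝ} (hh : ContDiff ℝ 1 h) :
    HasWeakGradient Ω (fun x => h (w x)) (fun x => deriv h (w x) • G x) := by
  have hh' : Continuous (deriv h) := hh.continuous_deriv le_rfl
  refine .of_approx hΩ.measurableSet (hh.continuous.comp_continuousOn hw)
    (hG.locallyIntegrable_grad.continuousOn_smul hΩ.isLocallyClosed
      (hh'.comp_continuousOn hw)) fun C hC hCΩ => ?_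
  have hwC := hw.mono hCΩ
  have hGC := hG.memLpLoc_one C hC hCΩ
  obtain ⟨W, hW, hWw, hWG⟩ := hG.exists_smooth_approx hΩ le_rfl hw hG.memLpLoc_one hC hCΩ
  rw [ENNReal.ofReal_one] at hWG hGC
  have hW₁ : ∀ k, ContDiff ℝ 1 (W k) := fun k => (hW k).of_le (by simp)
  have hgrad : ∀ k, ∇ (fun x => h (W k x)) = fun x => deriv h (W k x) • ∇ (W k) x := fun k =>
    funext fun x => gradient_fun_comp (hh.differentiable one_ne_zero _)
      ((hW₁ k).differentiable one_ne_zero x)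
  refine ⟨fun k x => h (W k x), fun k => hh.comp (hW₁ k),
    tendstoUniformlyOn_continuous_comp hC hwC hWw hh.continuous, ?_⟩
  simp only [hgrad]
  exact tendsto_eLpNorm_bilin (ContinuousLinearMap.lsmul ℝ ℝ) (p := ⊤) (q := 1)
    (fun k => memLp_restrict_of_continuousOn ⊤ hC
      (hh'.comp_continuousOn (hW k).continuous.continuousOn))
    (memLp_restrict_of_continuousOn ⊤ hC (hh'.comp_continuousOn hwC))
    (tendsto_eLpNorm_top_of_tendstoUniformlyOn hC.measurableSet
      (tendstoUniformlyOn_continuous_comp hC hwC hWw hh'))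
    (fun k => memLp_restrict_of_continuousOn 1 hC (continuous_gradient (hW₁ k)).continuousOn)
    hGC hWG

/-- The mollifications of `w` have vanishing gradient. -/
theorem HasWeakGradient.eq_of_ae_eq_zero {w : 𝔼 → ℝ} {G : 𝔼 → 𝔼} (hw : Continuous w)
    (hG : HasWeakGradient univ w G) (hG₀ : G =ᵐ[volume] 0) (x y : 𝔼) : w x = w y := by
  let φ : ℕ → ContDiffBump (0 : 𝔼) := fun k =>
    ⟨1 / ((k : ℝ) + 1) / 2, 1 / ((k : ℝ) + 1), by positivity, half_lt_self (by positivity)⟩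
  have hlim := ContDiffBump.convolution_tendsto_right_of_continuous (μ := (volume : Measure 𝔼))
    (φ := φ) tendsto_one_div_add_atTop_nhds_zero_nat hw
  refine tendsto_nhds_unique (hlim x) ((hlim y).congr fun k => ?_)
  refine is_const_of_fderiv_eq_zero (𝕜 := ℝ) ?_ (fun z => ?_) y x
  · exact ((φ k).hasCompactSupport_normed.contDiff_convolution_left _
      ((φ k).contDiff_normed (n := 1)) hw.locallyIntegrable).differentiable one_ne_zero
  · rw [← norm_eq_zero, ← norm_gradient, hG.gradient_convolution hw.locallyIntegrable
      (φ k).contDiff_normed (φ k).hasCompactSupport_normed (subset_univ _), convolution_lsmul_swap,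
      integral_eq_zero_of_ae, norm_zero]
    filter_upwards [hG₀] with t ht
    simp [ht]

end SobolevCalculus

section Testing

variable {n : ℕ} {Ω : Set (EuclideanSpace ℝ (Fin n))}

local notation "𝔼" => EuclideanSpace ℝ (Fin n)

/-- `-div B = f` in the distributional sense in `Ω`, for a vector field `B ∈ L^q_loc(Ω)` and
`f ∈ L^1_loc(Ω)`. -/
structure HasWeakNegDiv (Ω : Set 𝔼) (q : ℝ) (B : 𝔼 → 𝔼) (f : 𝔼 → ℝ) : Prop where
  memLpLoc : MemLpLoc Ω q B
  locallyIntegrable : LocallyIntegrableOn f Ω volume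
  integral_eq : ∀ φ : 𝔼 → ℝ, IsTestFunction Ω φ →
    ∫ x in Ω, inner ℝ (B x) (∇ φ x) = ∫ x in Ω, f x * φ x

theorem MemLpLoc.sub {F : Type*} [NormedAddCommGroup F] {p : ℝ} {G H : 𝔼 → F}
    (hG : MemLpLoc Ω p G) (hH : MemLpLoc Ω p H) : MemLpLoc Ω p (fun x => G x - H x) :=
  fun C hC hCΩ => (hG C hC hCΩ).sub (hH C hC hCΩ)

theorem integrableOn_inner_of_memLpLoc {p q : ℝ} (hpq : p.HolderConjugate q) {B G : 𝔼 → 𝔼}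
    (hB : MemLpLoc Ω q B) (hG : MemLpLoc Ω p G) {C : Set 𝔼} (hC : IsCompact C) (hCΩ : C ⊆ Ω) :
    IntegrableOn (fun x => inner ℝ (B x) (G x)) C volume := by
  have : (ENNReal.ofReal q).HolderConjugate (ENNReal.ofReal p) := hpq.symm.ennrealOfReal
  exact memLp_one_iff_integrable.1 ((innerSL ℝ).memLp_of_bilin 1 (hB C hC hCΩ) (hG C hC hCΩ))

theorem IsTestFunction.setIntegral_tsupport_eq {Ψ f : 𝔼 → ℝ} (hΨ : IsTestFunction Ω Ψ)
    (hf : ∀ x ∉ tsupport Ψ, f x = 0) : ∫ x in tsupport Ψ, f x = ∫ x in Ω, f x := by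
  rw [setIntegral_eq_integral_of_forall_compl_eq_zero hf,
    setIntegral_eq_integral_of_forall_compl_eq_zero fun x hx =>
      hf x fun h => hx (hΨ.support_subset h)]

theorem memLpLoc_of_continuous {F : Type*} [NormedAddCommGroup F] {p : ℝ} {G : 𝔼 → F}
    (hG : Continuous G) : MemLpLoc Ω p G :=
  fun _ hC _ => memLp_restrict_of_continuousOn _ hC hG.continuousOn

namespace HasWeakNegDiv

variable {p q : ℝ} {B B₁ B₂ G : EuclideanSpace ℝ (Fin n) → EuclideanSpace ℝ (Fin n)}
  {f f₁ f₂ w Ψ : EuclideanSpace ℝ (Fin n) → ℝ}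

theorem integrable_mul_inner_gradient (hpq : p.HolderConjugate q) (hB : HasWeakNegDiv Ω q B f)
    (hw : ContinuousOn w Ω) (hΨ : IsTestFunction Ω Ψ) :
    Integrable (fun x => w x * inner ℝ (B x) (∇ Ψ x)) volume :=
  ((integrableOn_inner_of_memLpLoc hpq hB.memLpLoc (memLpLoc_of_continuous hΨ.continuous_gradient)
    hΨ.compact_support hΨ.support_subset).continuousOn_mul (hw.mono hΨ.support_subset)
      hΨ.compact_support).integrable_of_forall_notMem_eq_zero fun x hx => by
      rw [gradient_eq_zero_of_notMem_tsupport hx, inner_zero_right, mul_zero]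

theorem integrable_inner_gradient (hpq : p.HolderConjugate q) (hB : HasWeakNegDiv Ω q B f)
    (hΨ : IsTestFunction Ω Ψ) : Integrable (fun x => inner ℝ (B x) (∇ Ψ x)) volume := by
  simpa only [one_mul] using
    hB.integrable_mul_inner_gradient hpq (w := fun _ => 1) continuousOn_const hΨ

theorem integrable_mul_inner (hpq : p.HolderConjugate q) (hB : HasWeakNegDiv Ω q B f)
    (hGp : MemLpLoc Ω p G) (hΨ : IsTestFunction Ω Ψ) :
    Integrable (fun x => Ψ x * inner ℝ (B x) (G x)) volume :=
  ((integrableOn_inner_of_memLpLoc hpq hB.memLpLoc hGp hΨ.compact_support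
    hΨ.support_subset).continuousOn_mul hΨ.smooth.continuous.continuousOn
      hΨ.compact_support).integrable_of_forall_notMem_eq_zero fun x hx => by
      rw [image_eq_zero_of_notMem_tsupport hx, zero_mul]

theorem integrable_mul (hB : HasWeakNegDiv Ω q B f) {φ : 𝔼 → ℝ} (hφ : IsTestFunction Ω φ) :
    Integrable (fun x => f x * φ x) volume :=
  integrable_bilin_of_hasCompactSupport (ContinuousLinearMap.mul ℝ ℝ).flip hφ.smooth.continuous
    hφ.compact_support hφ.support_subset hB.locallyIntegrable

theorem sub (hpq : p.HolderConjugate q) (h₁ : HasWeakNegDiv Ω q B₁ f₁)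
    (h₂ : HasWeakNegDiv Ω q B₂ f₂) :
    HasWeakNegDiv Ω q (fun x => B₁ x - B₂ x) (fun x => f₁ x - f₂ x) where
  memLpLoc := h₁.memLpLoc.sub h₂.memLpLoc
  locallyIntegrable := h₁.locallyIntegrable.sub h₂.locallyIntegrable
  integral_eq φ hφ := by
    simp only [inner_sub_left, sub_mul]
    rw [integral_sub (h₁.integrable_inner_gradient hpq hφ).integrableOn
        (h₂.integrable_inner_gradient hpq hφ).integrableOn, h₁.integral_eq φ hφ,
      h₂.integral_eq φ hφ, ← integral_sub (h₁.integrable_mul hφ).integrableOn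
        (h₂.integrable_mul hφ).integrableOn]

theorem integral_testing_of_contDiff (hpq : p.HolderConjugate q)
    (hB : HasWeakNegDiv Ω q B f) (hw : ContDiff ℝ ∞ w) (hΨ : IsTestFunction Ω Ψ) :
    (∫ x in Ω, Ψ x * inner ℝ (B x) (∇ w x)) + ∫ x in Ω, w x * inner ℝ (B x) (∇ Ψ x) =
      ∫ x in Ω, w x * (f x * Ψ x) := by
  have hwΨ : IsTestFunction Ω (fun x => w x * Ψ x) :=
    ⟨hw.mul hΨ.smooth, hΨ.compact_support.mul_left,
      tsupport_mul_subset_right.trans hΨ.support_subset⟩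
  have hΨw := hB.integrable_mul_inner hpq
    (memLpLoc_of_continuous (continuous_gradient (hw.of_le (by simp)))) hΨ
  have hwB := hB.integrable_mul_inner_gradient hpq hw.continuous.continuousOn hΨ
  rw [← integral_add hΨw.integrableOn hwB.integrableOn]
  refine Eq.trans ?_ ((hB.integral_eq _ hwΨ).trans ?_)
  all_goals congr 1 with x
  · rw [gradient_fun_mul (hw.differentiable (by simp) x) (hΨ.smooth.differentiable (by simp) x),
      inner_add_right, real_inner_smul_right, real_inner_smul_right]
    ring
  · ring

theorem integral_testing (hΩ : IsOpen Ω) (hpq : p.HolderConjugate q) (hB : HasWeakNegDiv Ω q B f)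
    (hw : ContinuousOn w Ω) (hG : HasWeakGradient Ω w G) (hGp : MemLpLoc Ω p G)
    (hΨ : IsTestFunction Ω Ψ) :
    (∫ x in Ω, Ψ x * inner ℝ (B x) (G x)) + ∫ x in Ω, w x * inner ℝ (B x) (∇ Ψ x) =
      ∫ x in Ω, w x * (f x * Ψ x) := by
  have : (ENNReal.ofReal q).HolderConjugate (ENNReal.ofReal p) := hpq.symm.ennrealOfReal
  have hC : IsCompact (tsupport Ψ) := hΨ.compact_support
  have hCΩ := hΨ.support_subset
  obtain ⟨W, hW, hWw, hWG⟩ := hG.exists_smooth_approx hΩ hpq.lt.le hw hGp hC hCΩ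
  have hWc : ∀ k, ContinuousOn (W k) (tsupport Ψ) := fun k => (hW k).continuous.continuousOn
  have hWg : ∀ k, Continuous (∇ (W k)) := fun k => continuous_gradient ((hW k).of_le (by simp))
  have hΨB : MemLp (fun x => Ψ x • B x) (ENNReal.ofReal q) (volume.restrict (tsupport Ψ)) :=
    (ContinuousLinearMap.lsmul ℝ ℝ).memLp_of_bilin _
      (memLp_restrict_of_continuousOn ⊤ hC hΨ.smooth.continuous.continuousOn)
      (hB.memLpLoc _ hC hCΩ)
  have hBΨ := (hB.integrable_inner_gradient hpq hΨ).integrableOn (s := tsupport Ψ)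
  have hgrad : Tendsto (fun k => ∫ x in tsupport Ψ, inner ℝ (Ψ x • B x) (∇ (W k) x)) atTop
      (𝓝 (∫ x in tsupport Ψ, inner ℝ (Ψ x • B x) (G x))) :=
    tendsto_integral_bilin (innerSL ℝ) (fun _ => hΨB) hΨB (by simp)
      (fun k => memLpLoc_of_continuous (hWg k) _ hC hCΩ) (hGp _ hC hCΩ) hWG
  have hflux := tendsto_setIntegral_smul_of_tendstoUniformlyOn hC hWc hWw hBΨ
  have hsource := tendsto_setIntegral_smul_of_tendstoUniformlyOn hC hWc hWw
    (hB.integrable_mul hΨ).integrableOn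
  have hgradΩ : ∀ H : 𝔼 → 𝔼, ∫ x in tsupport Ψ, Ψ x * inner ℝ (B x) (H x) =
      ∫ x in Ω, Ψ x * inner ℝ (B x) (H x) := fun H => hΨ.setIntegral_tsupport_eq fun x hx => by
    rw [image_eq_zero_of_notMem_tsupport hx, zero_mul]
  have hfluxΩ : ∀ v : 𝔼 → ℝ, ∫ x in tsupport Ψ, v x * inner ℝ (B x) (∇ Ψ x) =
      ∫ x in Ω, v x * inner ℝ (B x) (∇ Ψ x) := fun v => hΨ.setIntegral_tsupport_eq fun x hx => by
    rw [gradient_eq_zero_of_notMem_tsupport hx, inner_zero_right, mul_zero]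
  have hsourceΩ : ∀ v : 𝔼 → ℝ, ∫ x in tsupport Ψ, v x * (f x * Ψ x) =
      ∫ x in Ω, v x * (f x * Ψ x) := fun v => hΨ.setIntegral_tsupport_eq fun x hx => by
    rw [image_eq_zero_of_notMem_tsupport hx, mul_zero, mul_zero]
  simp only [real_inner_smul_left, smul_eq_mul, hgradΩ, hfluxΩ, hsourceΩ] at hgrad hflux hsource
  exact tendsto_nhds_unique (hgrad.add hflux)
    (hsource.congr fun k => (hB.integral_testing_of_contDiff hpq (hW k) hΨ).symm)

end HasWeakNegDiv

end Testing

section ZeroExtension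

variable {n : ℕ} {Ω S : Set (EuclideanSpace ℝ (Fin n))}

local notation "𝔼" => EuclideanSpace ℝ (Fin n)

theorem exists_isTestFunction_eventuallyEq (hΩ : IsOpen Ω) (hS : IsClosed S) (hSΩ : S ⊆ Ω)
    {Ψ : 𝔼 → ℝ} (hΨ : IsTestFunction univ Ψ) :
    ∃ Φ, IsTestFunction Ω Φ ∧ ∀ x ∈ S, Φ =ᶠ[𝓝 x] Ψ := by
  obtain ⟨χ, hχ₀, hχ₁, -⟩ := exists_contMDiffMap_zero_one_nhds_of_isClosed (n := (⊤ : ℕ∞))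
    (modelWithCornersSelf ℝ 𝔼) hΩ.isClosed_compl hS (disjoint_compl_left_iff_subset.2 hSΩ)
  refine ⟨fun x => χ x * Ψ x, ⟨χ.contMDiff.contDiff.mul hΨ.smooth,
    hΨ.compact_support.mul_left, fun x hx => ?_⟩, fun x hx => ?_⟩
  · by_contra hxΩ
    refine notMem_tsupport_iff_eventuallyEq.2 ?_ hx
    filter_upwards [eventually_nhdsSet_iff_forall.1 hχ₀ x hxΩ] with y hy
    simp [hy]
  · filter_upwards [eventually_nhdsSet_iff_forall.1 hχ₁ x hx] with y hy
    simp [hy]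

theorem locallyIntegrable_indicator_of_eqOn_zero {F : Type*} [NormedAddCommGroup F]
    (hΩ : IsOpen Ω) (hS : IsClosed S) (hSΩ : S ⊆ Ω) {g : 𝔼 → F}
    (hg : LocallyIntegrableOn g Ω volume) (hg₀ : EqOn g 0 (Ω \ S)) :
    LocallyIntegrable (Ω.indicator g) volume := fun x => by
  by_cases hx : x ∈ S
  · obtain ⟨U, hU, hgU⟩ := hg x (hSΩ hx)
    rw [hΩ.nhdsWithin_eq (hSΩ hx)] at hU
    exact ⟨U, hU, Integrable.indicator hgU hΩ.measurableSet⟩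
  · refine ⟨Sᶜ, hS.isOpen_compl.mem_nhds hx, integrableOn_zero.congr_fun (fun y hy => ?_)
      hS.isOpen_compl.measurableSet⟩
    by_cases hyΩ : y ∈ Ω
    · rw [indicator_of_mem hyΩ, hg₀ ⟨hyΩ, hy⟩, Pi.zero_apply]
    · rw [indicator_of_notMem hyΩ]

theorem HasWeakGradient.indicator (hΩ : IsOpen Ω) (hS : IsClosed S) (hSΩ : S ⊆ Ω) {w : 𝔼 → ℝ}
    {G : 𝔼 → 𝔼} (hG : HasWeakGradient Ω w G) (hw₀ : EqOn w 0 (Ω \ S)) (hG₀ : EqOn G 0 (Ω \ S)) :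
    HasWeakGradient univ (Ω.indicator w) (Ω.indicator G) where
  locallyIntegrable :=
    (locallyIntegrable_indicator_of_eqOn_zero hΩ hS hSΩ hG.locallyIntegrable
      hw₀).locallyIntegrableOn _
  locallyIntegrable_grad :=
    (locallyIntegrable_indicator_of_eqOn_zero hΩ hS hSΩ hG.locallyIntegrable_grad
      hG₀).locallyIntegrableOn _
  integral_eq Ψ hΨ := by
    obtain ⟨Φ, hΦ, hΦΨ⟩ := exists_isTestFunction_eventuallyEq hΩ hS hSΩ hΨ
    have hgrad : EqOn (fun x => w x • ∇ Φ x) (fun x => w x • ∇ Ψ x) Ω := fun x hx => by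
      by_cases hxS : x ∈ S
      · simp only [(hΦΨ x hxS).gradient_eq]
      · simp [hw₀ ⟨hx, hxS⟩]
    have hval : EqOn (fun x => Φ x • G x) (fun x => Ψ x • G x) Ω := fun x hx => by
      by_cases hxS : x ∈ S
      · simp only [(hΦΨ x hxS).eq_of_nhds]
      · simp [hG₀ ⟨hx, hxS⟩]
    simp only [Measure.restrict_univ, ← indicator_smul_left, ← indicator_smul]
    rw [integral_indicator hΩ.measurableSet, integral_indicator hΩ.measurableSet,
      ← setIntegral_congr_fun hΩ.measurableSet hgrad, hG.integral_eq Φ hΦ,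
      setIntegral_congr_fun hΩ.measurableSet hval]

theorem HasWeakNegDiv.testing_of_eqOn_zero (hΩ : IsOpen Ω) (hS : IsClosed S) (hSΩ : S ⊆ Ω)
    {p q : ℝ} (hpq : p.HolderConjugate q) {B : 𝔼 → 𝔼} {f : 𝔼 → ℝ} (hB : HasWeakNegDiv Ω q B f)
    {w : 𝔼 → ℝ} {G : 𝔼 → 𝔼} (hw : ContinuousOn w Ω) (hG : HasWeakGradient Ω w G)
    (hGp : MemLpLoc Ω p G) (hw₀ : EqOn w 0 (Ω \ S)) (hG₀ : EqOn G 0 (Ω \ S)) {Ψ : 𝔼 → ℝ}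
    (hΨ : IsTestFunction univ Ψ) :
    IntegrableOn (fun x => Ψ x * inner ℝ (B x) (G x)) Ω volume ∧
    (∫ x in Ω, Ψ x * inner ℝ (B x) (G x)) + ∫ x in Ω, w x * inner ℝ (B x) (∇ Ψ x) =
      ∫ x in Ω, w x * (f x * Ψ x) := by
  obtain ⟨Φ, hΦ, hΦΨ⟩ := exists_isTestFunction_eventuallyEq hΩ hS hSΩ hΨ
  have hgrad : EqOn (fun x => Φ x * inner ℝ (B x) (G x)) (fun x => Ψ x * inner ℝ (B x) (G x)) Ω :=
    fun x hx => by
      by_cases hxS : x ∈ S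
      · simp only [(hΦΨ x hxS).eq_of_nhds]
      · simp [hG₀ ⟨hx, hxS⟩]
  have hflux : EqOn (fun x => w x * inner ℝ (B x) (∇ Φ x)) (fun x => w x * inner ℝ (B x) (∇ Ψ x))
      Ω := fun x hx => by
    by_cases hxS : x ∈ S
    · simp only [(hΦΨ x hxS).gradient_eq]
    · simp [hw₀ ⟨hx, hxS⟩]
  have hsource : EqOn (fun x => w x * (f x * Φ x)) (fun x => w x * (f x * Ψ x)) Ω :=
    fun x hx => by
      by_cases hxS : x ∈ S
      · simp only [(hΦΨ x hxS).eq_of_nhds]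
      · simp [hw₀ ⟨hx, hxS⟩]
  have hm := hΩ.measurableSet
  refine ⟨((hB.integrable_mul_inner hpq hGp hΦ).integrableOn).congr_fun hgrad hm, ?_⟩
  rw [← setIntegral_congr_fun hm hgrad, ← setIntegral_congr_fun hm hflux,
    ← setIntegral_congr_fun hm hsource]
  exact hB.integral_testing hΩ hpq hw hG hGp hΦ

end ZeroExtension

section Structure

variable {n : ℕ} {K : Set (EuclideanSpace ℝ (Fin n))} {p : ℝ}
  {A : EuclideanSpace ℝ (Fin n) → EuclideanSpace ℝ (Fin n) → EuclideanSpace ℝ (Fin n)}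

local notation "𝔼" => EuclideanSpace ℝ (Fin n)

theorem inner_fderiv_eq_sum_partialEta (x η ξ : 𝔼) :
    inner ℝ (fderiv ℝ (A x) η ξ) ξ = ∑ i, ∑ j, partialEta A x η i j * ξ i * ξ j := by
  conv_lhs => enter [2]; rw [← (EuclideanSpace.basisFun (Fin n) ℝ).sum_repr ξ]
  simp only [map_sum, map_smul, sum_inner, PiLp.inner_apply,
    EuclideanSpace.basisFun_repr, EuclideanSpace.basisFun_apply, RCLike.inner_apply, conj_trivial,
    partialEta, PiLp.smul_apply, smul_eq_mul]
  exact Finset.sum_congr rfl fun i _ => Finset.sum_congr rfl fun j _ => by ring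

theorem norm_le_sum_abs (v : 𝔼) : ‖v‖ ≤ ∑ j, |v j| := by
  conv_lhs => rw [← (EuclideanSpace.basisFun (Fin n) ℝ).sum_repr v]
  refine (norm_sum_le _ _).trans (Finset.sum_le_sum fun j _ => ?_)
  simp [norm_smul]

theorem norm_fderiv_le_sum_partialEta (x η : 𝔼) :
    ‖fderiv ℝ (A x) η‖ ≤ ∑ i, ∑ j, |partialEta A x η i j| := by
  refine ContinuousLinearMap.opNorm_le_bound _ (by positivity) fun ξ => ?_
  conv_lhs => rw [← (EuclideanSpace.basisFun (Fin n) ℝ).sum_repr ξ]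
  simp only [map_sum, map_smul, EuclideanSpace.basisFun_repr, EuclideanSpace.basisFun_apply]
  rw [Finset.sum_mul]
  refine norm_sum_le_of_le _ fun i _ => ?_
  rw [norm_smul, mul_comm]
  exact mul_le_mul (norm_le_sum_abs (fderiv ℝ (A x) η (EuclideanSpace.single i 1)))
    (PiLp.norm_apply_le ξ i) (norm_nonneg _) (by positivity)

namespace StructureConditions

theorem exists_le_inner_fderiv (hA : StructureConditions K p A) :
    ∃ γ : ℝ, 0 < γ ∧ ∀ x ∈ Kᶜ, ∀ η : 𝔼, η ≠ 0 → ∀ ξ,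
      γ * ‖ξ‖ ^ 2 * ‖η‖ ^ (p - 2) ≤ inner ℝ (fderiv ℝ (A x) η ξ) ξ := by
  simpa only [inner_fderiv_eq_sum_partialEta] using hA.elliptic

theorem exists_norm_fderiv_le (hA : StructureConditions K p A) :
    ∃ Γ : ℝ, 0 < Γ ∧ ∀ x ∈ Kᶜ, ∀ η : 𝔼, η ≠ 0 → ‖fderiv ℝ (A x) η‖ ≤ Γ * ‖η‖ ^ (p - 2) :=
  let ⟨Γ, hΓ, h⟩ := hA.growth
  ⟨Γ, hΓ, fun x hx η hη => (norm_fderiv_le_sum_partialEta x η).trans (h x hx η hη)⟩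

theorem differentiableAt (hA : StructureConditions K p A) {x η : 𝔼} (hx : x ∈ Kᶜ)
    (hη : η ≠ 0) : DifferentiableAt ℝ (A x) η :=
  let ⟨_, _, hD⟩ := hA.contDiff
  ((hD (x, η) ⟨hx, hη⟩).comp η (hasFDerivAt_prodMk_right x η)).differentiableAt

theorem continuous (hA : StructureConditions K p A) {x : 𝔼} (hx : x ∈ Kᶜ) : Continuous (A x) :=
  hA.continuousOn.comp_continuous (by fun_prop : Continuous fun η : 𝔼 => (x, η))
    fun _ => ⟨subset_closure hx, mem_univ _⟩

theorem hasDerivAt_inner_lineMap (hA : StructureConditions K p A) {x : 𝔼} (hx : x ∈ Kᶜ)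
    {a b : 𝔼} (e : 𝔼) {t : ℝ} (ht : AffineMap.lineMap a b t ≠ (0 : 𝔼)) :
    HasDerivAt (fun s : ℝ => inner ℝ (A x (AffineMap.lineMap a b s)) e)
      (inner ℝ (fderiv ℝ (A x) (AffineMap.lineMap a b t) (b - a)) e) t := by
  simpa using ((hA.differentiableAt hx ht).hasFDerivAt.comp_hasDerivAt t
    AffineMap.hasDerivAt_lineMap).inner ℝ (hasDerivAt_const t e)

theorem continuous_inner_lineMap (hA : StructureConditions K p A) {x : 𝔼} (hx : x ∈ Kᶜ)
    (a b e : 𝔼) : Continuous fun s : ℝ => inner ℝ (A x (AffineMap.lineMap a b s)) e :=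
  ((hA.continuous hx).comp AffineMap.lineMap_continuous).inner continuous_const

theorem div_sub_one_le_inner (hA : StructureConditions K p A) (hp : 1 < p) {x : 𝔼}
    (hx : x ∈ Kᶜ) {η e : 𝔼} (hη : η ≠ 0) {c : ℝ}
    (hc : ∀ t ∈ Ioo (0 : ℝ) 1, c * t ^ (p - 2) ≤ inner ℝ (fderiv ℝ (A x) (t • η) η) e) :
    c / (p - 1) ≤ inner ℝ (A x η) e := by
  have hp₁ : 0 < p - 1 := sub_pos.2 hp
  set g : ℝ → ℝ := fun t => inner ℝ (A x (AffineMap.lineMap 0 η t)) e - c / (p - 1) * t ^ (p - 1)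
  have hg : MonotoneOn g (Icc 0 1) := by
    refine monotoneOn_of_hasDerivWithinAt_nonneg (convex_Icc 0 1)
      (f' := fun t => inner ℝ (fderiv ℝ (A x) (t • η) η) e - c * t ^ (p - 2))
      (((hA.continuous_inner_lineMap hx 0 η e).sub
        (continuous_const.mul (Real.continuous_rpow_const hp₁.le))).continuousOn)
      (fun t ht => ?_) fun t ht => sub_nonneg.2 (hc t (by rwa [interior_Icc] at ht))
    rw [interior_Icc] at ht
    have hline : AffineMap.lineMap 0 η t = t • η := by simp [AffineMap.lineMap_apply]
    have hinner := hA.hasDerivAt_inner_lineMap (a := 0) (b := η) hx e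
      (hline ▸ smul_ne_zero ht.1.ne' hη)
    have hpow := (Real.hasDerivAt_rpow_const (p := p - 1) (.inl ht.1.ne')).const_mul (c / (p - 1))
    rw [hline, sub_zero] at hinner
    rw [← mul_assoc, div_mul_cancel₀ _ hp₁.ne', show p - 1 - 1 = p - 2 by ring] at hpow
    exact (hinner.sub hpow).hasDerivWithinAt
  have h01 := hg (left_mem_Icc.2 zero_le_one) (right_mem_Icc.2 zero_le_one) zero_le_one
  simpa [g, hA.map_zero x hx, Real.zero_rpow hp₁.ne'] using h01

theorem exists_norm_le (hA : StructureConditions K p A) (hp : 1 < p) :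
    ∃ C : ℝ, ∀ x ∈ Kᶜ, ∀ η : 𝔼, ‖A x η‖ ≤ C * ‖η‖ ^ (p - 1) := by
  obtain ⟨Γ, hΓ, hgrowth⟩ := hA.exists_norm_fderiv_le
  have : 0 < p - 1 := sub_pos.2 hp
  refine ⟨Γ / (p - 1), fun x hx η => ?_⟩
  rcases eq_or_ne η 0 with rfl | hη
  · rw [hA.map_zero x hx, norm_zero]; positivity
  have hpow : ‖η‖ ^ (p - 1) = ‖η‖ ^ (p - 2) * ‖η‖ := by
    rw [← Real.rpow_add_one (norm_ne_zero_iff.2 hη)]; ring_nf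
  have hle := hA.div_sub_one_le_inner hp hx hη (e := -A x η)
    (c := -(Γ * ‖η‖ ^ (p - 1) * ‖A x η‖)) fun t ht => by
      rw [inner_neg_right, neg_mul, neg_le_neg_iff]
      calc inner ℝ (fderiv ℝ (A x) (t • η) η) (A x η)
          ≤ ‖fderiv ℝ (A x) (t • η)‖ * ‖η‖ * ‖A x η‖ :=
            (real_inner_le_norm _ _).trans (by gcongr; exact ContinuousLinearMap.le_opNorm _ _)
        _ ≤ Γ * ‖t • η‖ ^ (p - 2) * ‖η‖ * ‖A x η‖ := by
            gcongr; exact hgrowth x hx _ (smul_ne_zero ht.1.ne' hη)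
        _ = Γ * ‖η‖ ^ (p - 1) * ‖A x η‖ * t ^ (p - 2) := by
            rw [norm_smul, Real.norm_of_nonneg ht.1.le, Real.mul_rpow ht.1.le (norm_nonneg _),
              hpow]
            ring
  rw [inner_neg_right, real_inner_self_eq_norm_mul_norm, neg_div, neg_le_neg_iff,
    mul_div_right_comm, mul_div_right_comm] at hle
  rcases eq_or_ne (A x η) 0 with h₀ | h₀
  · rw [h₀, norm_zero]; positivity
  · exact le_of_mul_le_mul_right hle (norm_pos_iff.2 h₀)

theorem exists_le_inner (hA : StructureConditions K p A) (hp : 1 < p) :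
    ∃ c : ℝ, 0 < c ∧ ∀ x ∈ Kᶜ, ∀ η : 𝔼, c * ‖η‖ ^ p ≤ inner ℝ (A x η) η := by
  obtain ⟨γ, hγ, hell⟩ := hA.exists_le_inner_fderiv
  have : 0 < p - 1 := sub_pos.2 hp
  refine ⟨γ / (p - 1), by positivity, fun x hx η => ?_⟩
  rcases eq_or_ne η 0 with rfl | hη
  · simp [Real.zero_rpow (zero_lt_one.trans hp).ne']
  have hpow : ‖η‖ ^ p = ‖η‖ ^ 2 * ‖η‖ ^ (p - 2) := by
    rw [← Real.rpow_natCast, ← Real.rpow_add (norm_pos_iff.2 hη)]; norm_num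
  have hle := hA.div_sub_one_le_inner hp hx hη (e := η) (c := γ * ‖η‖ ^ p) fun t ht => by
    refine le_trans (le_of_eq ?_) (hell x hx _ (smul_ne_zero ht.1.ne' hη) η)
    rw [norm_smul, Real.norm_of_nonneg ht.1.le, Real.mul_rpow ht.1.le (norm_nonneg _), hpow]
    ring
  rwa [mul_div_right_comm] at hle

theorem inner_lineMap_lt (hA : StructureConditions K p A) {x : 𝔼} (hx : x ∈ Kᶜ) {a b : 𝔼}
    (hab : a ≠ b) {s t : ℝ} (hst : s < t)
    (h₀ : ∀ r ∈ Ioo s t, AffineMap.lineMap a b r ≠ (0 : 𝔼)) :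
    inner ℝ (A x (AffineMap.lineMap a b s)) (b - a) <
      inner ℝ (A x (AffineMap.lineMap a b t)) (b - a) := by
  obtain ⟨γ, hγ, hell⟩ := hA.exists_le_inner_fderiv
  refine strictMonoOn_of_deriv_pos (convex_Icc s t)
    (hA.continuous_inner_lineMap hx a b (b - a)).continuousOn (fun r hr => ?_)
    (left_mem_Icc.2 hst.le) (right_mem_Icc.2 hst.le) hst
  rw [interior_Icc] at hr
  rw [(hA.hasDerivAt_inner_lineMap hx _ (h₀ r hr)).deriv]
  have := norm_pos_iff.2 (sub_ne_zero.2 hab.symm)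
  have := norm_pos_iff.2 (h₀ r hr)
  exact lt_of_lt_of_le (by positivity) (hell x hx _ (h₀ r hr) (b - a))

theorem inner_sub_pos (hA : StructureConditions K p A) {x : 𝔼} (hx : x ∈ Kᶜ) {a b : 𝔼}
    (hab : a ≠ b) : 0 < inner ℝ (A x b - A x a) (b - a) := by
  suffices inner ℝ (A x (AffineMap.lineMap a b (0 : ℝ))) (b - a) <
      inner ℝ (A x (AffineMap.lineMap a b (1 : ℝ))) (b - a) by
    simpa [inner_sub_left] using this
  by_cases! h₀ : ∀ r ∈ Ioo (0 : ℝ) 1, AffineMap.lineMap a b r ≠ (0 : 𝔼)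
  · exact hA.inner_lineMap_lt hx hab one_pos h₀
  · obtain ⟨r, hr, hr₀⟩ := h₀
    have hunique : ∀ s : ℝ, AffineMap.lineMap a b s = (0 : 𝔼) → s = r := fun s hs =>
      AffineMap.lineMap_injective ℝ hab (hs.trans hr₀.symm)
    exact (hA.inner_lineMap_lt hx hab hr.1 fun s hs h => hs.2.ne (hunique s h)).trans
      (hA.inner_lineMap_lt hx hab hr.2 fun s hs h => hs.1.ne' (hunique s h))

theorem aestronglyMeasurable (hA : StructureConditions K p A) {S : Set 𝔼} (hS : MeasurableSet S)
    (hSK : S ⊆ Kᶜ) {G : 𝔼 → 𝔼} (hG : AEStronglyMeasurable G (volume.restrict S)) :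
    AEStronglyMeasurable (fun x => A x (G x)) (volume.restrict S) := by
  classical
  have hm : MeasurableSet (S ×ˢ (univ : Set 𝔼)) := hS.prod .univ
  have hpw : Measurable ((S ×ˢ (univ : Set 𝔼)).piecewise (Function.uncurry A) 0) :=
    (hA.continuousOn.mono (prod_mono (hSK.trans subset_closure) subset_rfl)).measurable_piecewise
      continuousOn_const hm
  refine (hpw.comp_aemeasurable (aemeasurable_id.prodMk hG.aemeasurable)).aestronglyMeasurable.congr
    (ae_restrict_of_forall_mem hS fun x hx => ?_)
  exact piecewise_eq_of_mem _ _ _ (mk_mem_prod hx (mem_univ _))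

theorem memLp (hA : StructureConditions K p A) {q : ℝ} (hpq : p.HolderConjugate q) {S : Set 𝔼}
    (hS : MeasurableSet S) (hSK : S ⊆ Kᶜ) {G : 𝔼 → 𝔼}
    (hG : MemLp G (ENNReal.ofReal p) (volume.restrict S)) :
    MemLp (fun x => A x (G x)) (ENNReal.ofReal q) (volume.restrict S) := by
  obtain ⟨C, hbd⟩ := hA.exists_norm_le hpq.lt
  have hpow := hG.norm_rpow_div (ENNReal.ofReal (p - 1))
  rw [← ENNReal.ofReal_div_of_pos hpq.sub_one_pos, ENNReal.toReal_ofReal hpq.sub_one_pos.le,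
    ← hpq.conjugate_eq] at hpow
  refine hpow.of_le_mul (c := C) (hA.aestronglyMeasurable hS hSK hG.1)
    (ae_restrict_of_forall_mem hS fun x hx => ?_)
  rw [Real.norm_of_nonneg (by positivity)]
  exact hbd x (hSK hx) (G x)

end StructureConditions

end Structure

section Cutoff

variable {n : ℕ}

local notation "𝔼" => EuclideanSpace ℝ (Fin n)

/-- A smooth bump function on `ℝⁿ`, equal to `1` on the unit ball and supported in the ball of
radius `2`; the profile of all cutoffs. -/
noncomputable def unitBump (n : ℕ) : ContDiffBump (0 : EuclideanSpace ℝ (Fin n)) :=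
  ⟨1, 2, one_pos, one_lt_two⟩

/-- The cutoff function at scale `R`: for `R > 0` it is `1` on the ball of radius `R` and vanishes
off the ball of radius `2 * R`. -/
noncomputable def cutoff (R : ℝ) (x : EuclideanSpace ℝ (Fin n)) : ℝ := unitBump n (R⁻¹ • x)

theorem cutoff_nonneg (R : ℝ) (x : 𝔼) : 0 ≤ cutoff R x := (unitBump n).nonneg

theorem cutoff_le_one (R : ℝ) (x : 𝔼) : cutoff R x ≤ 1 := (unitBump n).le_one

theorem cutoff_eq_one {R : ℝ} (hR : 0 < R) {x : 𝔼} (hx : ‖x‖ ≤ R) : cutoff R x = 1 := by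
  refine (unitBump n).one_of_mem_closedBall ?_
  rw [mem_closedBall_zero_iff, norm_smul, norm_inv, Real.norm_of_nonneg hR.le]
  exact (inv_mul_le_iff₀ hR).2 (by simpa [unitBump] using hx)

theorem cutoff_eq_zero {R : ℝ} (hR : 0 < R) {x : 𝔼} (hx : 2 * R ≤ ‖x‖) : cutoff R x = 0 := by
  refine (unitBump n).zero_of_le_dist ?_
  rw [dist_zero_right, norm_smul, norm_inv, Real.norm_of_nonneg hR.le, le_inv_mul_iff₀ hR]
  simpa [unitBump, mul_comm] using hx

theorem isTestFunction_cutoff {R : ℝ} (hR : 0 < R) : IsTestFunction univ (cutoff R : 𝔼 → ℝ) where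
  smooth := (unitBump n).contDiff.comp (contDiff_const_smul _)
  compact_support := .intro (isCompact_closedBall 0 (2 * R)) fun x hx =>
    cutoff_eq_zero hR (by simpa using hx : 2 * R < ‖x‖).le
  support_subset := subset_univ _

theorem gradient_cutoff (R : ℝ) (x : 𝔼) :
    ∇ (cutoff R) x = R⁻¹ • ∇ (unitBump n) (R⁻¹ • x) := by
  refine ext_inner_right ℝ fun e => ?_
  have hd : HasFDerivAt (cutoff R : 𝔼 → ℝ) ((fderiv ℝ (unitBump n) (R⁻¹ • x)).comp
      (R⁻¹ • ContinuousLinearMap.id ℝ 𝔼)) x :=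
    ((unitBump n).contDiff (n := 1)).differentiable one_ne_zero _ |>.hasFDerivAt.comp x
      ((hasFDerivAt_id x).const_smul R⁻¹)
  rw [inner_gradient_left, real_inner_smul_left, inner_gradient_left, hd.fderiv]
  simp

theorem gradient_cutoff_eq_zero {R : ℝ} (hR : 0 < R) {x : 𝔼} (hx : ‖x‖ < R) :
    ∇ (cutoff R) x = 0 := by
  have hev : (cutoff R : 𝔼 → ℝ) =ᶠ[𝓝 x] fun _ => 1 := by
    filter_upwards [isOpen_ball.mem_nhds (mem_ball_zero_iff.2 hx)] with y hy
    exact cutoff_eq_one hR (mem_ball_zero_iff.1 hy).le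
  rw [hev.gradient_eq, gradient_fun_const]

theorem integrable_norm_rpow_of_memLp {μ : Measure 𝔼} {G : 𝔼 → 𝔼} {p : ℝ} (hp : 0 < p)
    (hG : MemLp G (ENNReal.ofReal p) μ) : Integrable (fun x => ‖G x‖ ^ p) μ := by
  simpa only [ENNReal.toReal_ofReal hp.le] using
    hG.integrable_norm_rpow (ENNReal.ofReal_pos.2 hp).ne' ENNReal.ofReal_ne_top

theorem IsTestFunction.memLp_gradient {Ω : Set 𝔼} {φ : 𝔼 → ℝ} (hφ : IsTestFunction Ω φ)
    (p : ENNReal) : MemLp (∇ φ) p volume :=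
  hφ.continuous_gradient.memLp_of_hasCompactSupport hφ.hasCompactSupport_gradient

theorem IsTestFunction.integrable_norm_gradient_rpow {Ω : Set 𝔼} {φ : 𝔼 → ℝ}
    (hφ : IsTestFunction Ω φ) {p : ℝ} (hp : 0 < p) :
    Integrable (fun x => ‖∇ φ x‖ ^ p) volume :=
  integrable_norm_rpow_of_memLp hp (hφ.memLp_gradient _)

/-- Scaling: the `p`-energy of `cutoff R` is `R ^ (n - p)` times that of the profile. This is where
`p ≥ n` enters. -/
theorem integral_norm_gradient_cutoff_le {p : ℝ} (hp : (n : ℝ) ≤ p) {R : ℝ} (hR : 1 ≤ R) :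
    ∫ x : 𝔼, ‖∇ (cutoff R) x‖ ^ p ≤ ∫ x, ‖∇ (unitBump n) x‖ ^ p := by
  have hR₀ : 0 < R := one_pos.trans_le hR
  calc ∫ x : 𝔼, ‖∇ (cutoff R) x‖ ^ p
      = ∫ x : 𝔼, R⁻¹ ^ p * ‖∇ (unitBump n) (R⁻¹ • x)‖ ^ p := by
        simp only [gradient_cutoff, norm_smul, Real.norm_of_nonneg (inv_nonneg.2 hR₀.le),
          Real.mul_rpow (inv_nonneg.2 hR₀.le) (norm_nonneg _)]
    _ = R⁻¹ ^ p * R ^ (n : ℝ) * ∫ x, ‖∇ (unitBump n) x‖ ^ p := by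
        rw [integral_const_mul,
          Measure.integral_comp_inv_smul volume (fun y : 𝔼 => ‖∇ (unitBump n) y‖ ^ p),
          finrank_euclideanSpace_fin, smul_eq_mul, abs_of_nonneg (by positivity), mul_assoc,
          Real.rpow_natCast]
    _ ≤ ∫ x, ‖∇ (unitBump n) x‖ ^ p := by
        refine mul_le_of_le_one_left (integral_nonneg fun x => by positivity) ?_
        rw [Real.inv_rpow hR₀.le, inv_mul_le_one₀ (by positivity)]
        exact Real.rpow_le_rpow_of_exponent_le hR hp

theorem tendsto_setIntegral_norm_ge {g : 𝔼 → ℝ} {R₀ : ℝ}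
    (hg : IntegrableOn g {x | R₀ ≤ ‖x‖} volume) :
    Tendsto (fun k : ℕ => ∫ x in {x : 𝔼 | (k : ℝ) ≤ ‖x‖}, g x) atTop (𝓝 0) := by
  obtain ⟨k₀, hk₀⟩ := exists_nat_ge R₀
  have hempty : ⋂ k : ℕ, {x : 𝔼 | (k : ℝ) ≤ ‖x‖} = ∅ := by
    refine eq_empty_of_forall_notMem fun x hx => ?_
    obtain ⟨k, hk⟩ := exists_nat_gt ‖x‖
    exact hk.not_ge (mem_iInter.1 hx k)
  simpa [hempty] using tendsto_setIntegral_of_antitone (μ := volume) (f := g)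
    (s := fun k : ℕ => {x : 𝔼 | (k : ℝ) ≤ ‖x‖})
    (fun k => (isClosed_le continuous_const continuous_norm).measurableSet)
    (fun i j hij x (hx : (j : ℝ) ≤ ‖x‖) => (Nat.cast_le.2 hij).trans hx)
    ⟨k₀, hg.mono_set fun x hx => hk₀.trans hx⟩

theorem abs_setIntegral_mul_inner_gradient_cutoff_le {p q : ℝ} (hpq : p.HolderConjugate q)
    {Ω : Set 𝔼} (hΩ : MeasurableSet Ω) {w : 𝔼 → ℝ} {M : ℝ} (hM : 0 ≤ M)
    (hw : ∀ x ∈ Ω, |w x| ≤ M) {R : ℝ} (hR : 0 < R) {B : 𝔼 → 𝔼}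
    (hB : MemLp B (ENNReal.ofReal q) (volume.restrict {x | R ≤ ‖x‖})) :
    |∫ x in Ω, w x * inner ℝ (B x) (∇ (cutoff R) x)| ≤
      M * ((∫ x in {x | R ≤ ‖x‖}, ‖B x‖ ^ q) ^ (1 / q) *
        (∫ x : 𝔼, ‖∇ (cutoff R) x‖ ^ p) ^ (1 / p)) := by
  set T : Set 𝔼 := {x | R ≤ ‖x‖}
  have hT : MeasurableSet T := (isClosed_le continuous_const continuous_norm).measurableSet
  have hφ := isTestFunction_cutoff (n := n) hR
  have : (ENNReal.ofReal q).HolderConjugate (ENNReal.ofReal p) := hpq.symm.ennrealOfReal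
  have hint : IntegrableOn (fun x => ‖B x‖ * ‖∇ (cutoff R) x‖) T volume :=
    memLp_one_iff_integrable.1
      (((hφ.memLp_gradient (ENNReal.ofReal p)).restrict T).norm.mul hB.norm)
  have hle : ∀ x ∈ Ω, ‖w x * inner ℝ (B x) (∇ (cutoff R) x)‖ ≤
      T.indicator (fun x => M * (‖B x‖ * ‖∇ (cutoff R) x‖)) x := fun x hx => by
    by_cases hxT : x ∈ T
    · rw [indicator_of_mem hxT, norm_mul]
      exact mul_le_mul (hw x hx) (norm_inner_le_norm _ _) (norm_nonneg _) hM
    · rw [indicator_of_notMem hxT, gradient_cutoff_eq_zero hR (not_le.1 hxT), inner_zero_right,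
        mul_zero, norm_zero]
  have hind : Integrable (T.indicator fun x => M * (‖B x‖ * ‖∇ (cutoff R) x‖)) volume :=
    (integrable_indicator_iff hT).2 (hint.const_mul M)
  calc |∫ x in Ω, w x * inner ℝ (B x) (∇ (cutoff R) x)|
      ≤ ∫ x in Ω, T.indicator (fun x => M * (‖B x‖ * ‖∇ (cutoff R) x‖)) x :=
        norm_integral_le_of_norm_le hind.integrableOn (ae_restrict_of_forall_mem hΩ hle)
    _ ≤ M * ∫ x in T, ‖B x‖ * ‖∇ (cutoff R) x‖ := by
        rw [← integral_const_mul, ← integral_indicator hT]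
        exact setIntegral_le_integral hind
          (.of_forall fun x => indicator_nonneg (fun y _ => by positivity) x)
    _ ≤ M * ((∫ x in T, ‖B x‖ ^ q) ^ (1 / q) * (∫ x in T, ‖∇ (cutoff R) x‖ ^ p) ^ (1 / p)) := by
        gcongr
        exact integral_mul_norm_le_Lp_mul_Lq hpq.symm hB ((hφ.memLp_gradient _).restrict T)
    _ ≤ _ := by
        refine mul_le_mul_of_nonneg_left (mul_le_mul_of_nonneg_left ?_ (by positivity)) hM
        exact Real.rpow_le_rpow (by positivity) (setIntegral_le_integral
          (hφ.integrable_norm_gradient_rpow hpq.pos) (.of_forall fun x => by positivity))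
          hpq.one_div_nonneg

theorem tendsto_setIntegral_mul_inner_gradient_cutoff {p q : ℝ} (hpq : p.HolderConjugate q)
    (hpn : (n : ℝ) ≤ p) {Ω : Set 𝔼} (hΩ : MeasurableSet Ω) {w : 𝔼 → ℝ} {M : ℝ}
    (hw : ∀ x ∈ Ω, |w x| ≤ M) {B : 𝔼 → 𝔼} {R₀ : ℝ}
    (hB : MemLp B (ENNReal.ofReal q) (volume.restrict {x | R₀ ≤ ‖x‖})) :
    Tendsto (fun k : ℕ => ∫ x in Ω, w x * inner ℝ (B x) (∇ (cutoff k) x)) atTop (𝓝 0) := by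
  have hBq : IntegrableOn (fun x => ‖B x‖ ^ q) {x | R₀ ≤ ‖x‖} volume :=
    integrable_norm_rpow_of_memLp hpq.symm.pos hB
  set N : ℝ := ∫ x : 𝔼, ‖∇ (unitBump n) x‖ ^ p
  have htail : Tendsto (fun k : ℕ => max M 0 *
      ((∫ x in {x | (k : ℝ) ≤ ‖x‖}, ‖B x‖ ^ q) ^ (1 / q) * N ^ (1 / p))) atTop (𝓝 0) := by
    have := (tendsto_setIntegral_norm_ge hBq).rpow_const (p := 1 / q) (.inr hpq.symm.one_div_nonneg)
    rw [Real.zero_rpow hpq.symm.one_div_ne_zero] at this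
    simpa using (this.mul_const (N ^ (1 / p))).const_mul (max M 0)
  refine squeeze_zero_norm' ?_ htail
  obtain ⟨k₀, hk₀⟩ := exists_nat_ge R₀
  filter_upwards [eventually_ge_atTop k₀, eventually_ge_atTop 1] with k hk hk₁
  have hk₁' : (1 : ℝ) ≤ k := Nat.one_le_cast.2 hk₁
  have hsub : {x : 𝔼 | (k : ℝ) ≤ ‖x‖} ⊆ {x | R₀ ≤ ‖x‖} := fun x hx =>
    (hk₀.trans (Nat.cast_le.2 hk)).trans hx
  refine (abs_setIntegral_mul_inner_gradient_cutoff_le hpq hΩ (le_max_right M 0)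
    (fun x hx => (hw x hx).trans (le_max_left _ _)) (one_pos.trans_le hk₁')
    (hB.mono_measure (Measure.restrict_mono hsub le_rfl))).trans ?_
  have hN := Real.rpow_le_rpow (by positivity) (integral_norm_gradient_cutoff_le hpn hk₁')
    hpq.one_div_nonneg
  gcongr

end Cutoff

section Caccioppoli

variable {n : ℕ}

local notation "𝔼" => EuclideanSpace ℝ (Fin n)

theorem pow_pred_mul_rpow_mul_le {m : ℕ} {p s a b δ : ℝ} (hp : 1 < p) (hm : p ≤ m)
    (hs : s ∈ Icc (0 : ℝ) 1) (ha : 0 ≤ a) (hb : 0 ≤ b) (hδ : 0 < δ) :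
    s ^ (m - 1) * a ^ (p - 1) * b ≤ δ * (s ^ m * a ^ p) + δ ^ (1 - p) * b ^ p := by
  have hm₀ : m ≠ 0 := fun h => by simp only [h, Nat.cast_zero] at hm; linarith
  have hs₀ := hs.1
  have hsplit : ∀ {c : ℝ}, 0 ≤ c → c ^ p = c ^ (p - 1) * c := fun hc => by
    rw [← Real.rpow_add_one' hc (by linarith), sub_add_cancel]
  rcases le_total b (δ * (s * a)) with h | h
  · calc s ^ (m - 1) * a ^ (p - 1) * b ≤ s ^ (m - 1) * a ^ (p - 1) * (δ * (s * a)) := by gcongr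
      _ = δ * (s ^ m * a ^ p) := by rw [hsplit ha, ← pow_sub_one_mul hm₀ s]; ring
      _ ≤ _ := le_add_of_nonneg_right (by positivity)
  · calc s ^ (m - 1) * a ^ (p - 1) * b ≤ s ^ (p - 1) * a ^ (p - 1) * b := by
          gcongr
          rw [← Real.rpow_natCast, Nat.cast_pred (Nat.pos_of_ne_zero hm₀)]
          exact Real.rpow_le_rpow_of_exponent_ge' hs₀ hs.2 (by linarith) (by linarith)
      _ = (s * a) ^ (p - 1) * b := by rw [Real.mul_rpow hs₀ ha]
      _ ≤ (δ⁻¹ * b) ^ (p - 1) * b := by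
          have := (le_inv_mul_iff₀ hδ).2 h
          gcongr ?_ ^ (p - 1) * b
      _ = δ ^ (1 - p) * b ^ p := by
          rw [Real.mul_rpow (by positivity) hb, hsplit hb, Real.inv_rpow hδ.le,
            ← Real.rpow_neg hδ.le, neg_sub, mul_assoc]
      _ ≤ _ := le_add_of_nonneg_left (by positivity)

theorem exists_neg_mul_inner_pow_le {p M C c : ℝ} (hp : 1 < p) (hC : 0 ≤ C) (hc : 0 < c)
    {m : ℕ} (hm : p ≤ m) :
    ∃ Λ : ℝ, 0 ≤ Λ ∧ ∀ {w s : ℝ} {b G g : 𝔼}, |w| ≤ M → s ∈ Icc (0 : ℝ) 1 →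
      ‖b‖ ≤ C * ‖G‖ ^ (p - 1) →
      -(w * inner ℝ b ((m * s ^ (m - 1)) • g)) ≤ c / 2 * (s ^ m * ‖G‖ ^ p) + Λ * ‖g‖ ^ p := by
  set L := max M 0 * m * C
  have : 0 ≤ L := by positivity
  have hδ : 0 < c / (2 * (L + 1)) := by positivity
  set δ := c / (2 * (L + 1))
  have hLδ : L * δ ≤ c / 2 := by
    rw [mul_div_assoc', div_le_div_iff₀ (by positivity) two_pos]
    nlinarith
  refine ⟨L * δ ^ (1 - p), by positivity, fun {w s b G g} hw hs hb => ?_⟩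
  have hs₀ := hs.1
  calc -(w * inner ℝ b ((m * s ^ (m - 1)) • g))
      ≤ |w| * (‖b‖ * (m * s ^ (m - 1) * ‖g‖)) := by
        refine (neg_le_abs _).trans ?_
        rw [abs_mul]
        gcongr
        refine (abs_real_inner_le_norm _ _).trans_eq ?_
        rw [norm_smul, Real.norm_of_nonneg (by positivity)]
    _ ≤ max M 0 * (C * ‖G‖ ^ (p - 1) * (m * s ^ (m - 1) * ‖g‖)) := by
        gcongr
        exact hw.trans (le_max_left _ _)
    _ = L * (s ^ (m - 1) * ‖G‖ ^ (p - 1) * ‖g‖) := by ring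
    _ ≤ L * (δ * (s ^ m * ‖G‖ ^ p) + δ ^ (1 - p) * ‖g‖ ^ p) := by
        gcongr
        exact pow_pred_mul_rpow_mul_le hp hm hs (norm_nonneg _) (norm_nonneg _) hδ
    _ = L * δ * (s ^ m * ‖G‖ ^ p) + L * δ ^ (1 - p) * ‖g‖ ^ p := by ring
    _ ≤ _ := by gcongr

variable {Ω : Set (EuclideanSpace ℝ (Fin n))} {p q M C c : ℝ}
  {B G : EuclideanSpace ℝ (Fin n) → EuclideanSpace ℝ (Fin n)}
  {f w ψ : EuclideanSpace ℝ (Fin n) → ℝ} {m : ℕ}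

theorem IsTestFunction.pow (hψ : IsTestFunction Ω ψ) (hm : m ≠ 0) :
    IsTestFunction Ω (fun x => ψ x ^ m) where
  smooth := hψ.smooth.pow m
  compact_support := hψ.compact_support.comp_left (g := (· ^ m)) (zero_pow hm)
  support_subset := (closure_mono (Function.support_pow ψ hm).subset).trans hψ.support_subset

theorem gradient_fun_pow {x : 𝔼} (hψ : DifferentiableAt ℝ ψ x) :
    ∇ (fun y => ψ y ^ m) x = (m * ψ x ^ (m - 1)) • ∇ ψ x := by
  rw [gradient_fun_comp (h := (· ^ m)) (differentiableAt_pow m) hψ, deriv_pow_field]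

theorem MemLpLoc.integrable_mul_norm_rpow (hp : 0 < p) (hG : MemLpLoc Ω p G)
    (hψ : IsTestFunction Ω ψ) : Integrable (fun x => ψ x * ‖G x‖ ^ p) volume :=
  have hGψ : IntegrableOn (fun x => ‖G x‖ ^ p) (tsupport ψ) volume :=
    integrable_norm_rpow_of_memLp hp (hG _ hψ.compact_support hψ.support_subset)
  (hGψ.continuousOn_mul hψ.smooth.continuous.continuousOn
    hψ.compact_support).integrable_of_forall_notMem_eq_zero fun x hx => by
      rw [image_eq_zero_of_notMem_tsupport hx, zero_mul]

/-- Testing with `w * ψ ^ m`: the power `m ≥ p` of `ψ` lets Young's inequality absorb the term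
containing `∇ ψ` into the energy. -/
theorem HasWeakNegDiv.exists_caccioppoli (hΩ : IsOpen Ω) (hpq : p.HolderConjugate q)
    (hB : HasWeakNegDiv Ω q B f) (hw : ContinuousOn w Ω) (hM : ∀ x ∈ Ω, |w x| ≤ M)
    (hG : HasWeakGradient Ω w G) (hGp : MemLpLoc Ω p G)
    (hgrowth : ∀ x ∈ Ω, ‖B x‖ ≤ C * ‖G x‖ ^ (p - 1)) (hc : 0 < c)
    (hcoer : ∀ x ∈ Ω, c * ‖G x‖ ^ p ≤ inner ℝ (B x) (G x)) (hm : p ≤ m) :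
    ∃ Λ : ℝ, 0 ≤ Λ ∧ ∀ ψ, IsTestFunction Ω ψ → (∀ x, ψ x ∈ Icc (0 : ℝ) 1) →
      ∫ x in Ω, ψ x ^ m * ‖G x‖ ^ p ≤
        Λ * ((∫ x in Ω, |f x * ψ x ^ m|) + ∫ x in Ω, ‖∇ ψ x‖ ^ p) := by
  obtain ⟨Λ, hΛ, habsorb⟩ := exists_neg_mul_inner_pow_le (n := n) (M := M) hpq.lt
    (le_max_right C 0) hc hm
  have hm₀ : m ≠ 0 := Nat.cast_pos.1 (hpq.pos.trans_le hm) |>.ne'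
  refine ⟨2 / c * (max M 0 + Λ), by positivity, fun ψ hψ hψ₁ => ?_⟩
  have hΨ := hψ.pow hm₀
  set X := ∫ x in Ω, ψ x ^ m * ‖G x‖ ^ p
  set F := ∫ x in Ω, |f x * ψ x ^ m|
  set D := ∫ x in Ω, ‖∇ ψ x‖ ^ p
  have hX := (hGp.integrable_mul_norm_rpow hpq.pos hΨ).integrableOn (s := Ω)
  have hD := (hψ.integrable_norm_gradient_rpow hpq.pos).integrableOn (s := Ω)
  have hBG := (hB.integrable_mul_inner hpq hGp hΨ).integrableOn (s := Ω)
  have hBψ := (hB.integrable_mul_inner_gradient hpq hw hΨ).integrableOn (s := Ω)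
  have henergy : c * X ≤ ∫ x in Ω, ψ x ^ m * inner ℝ (B x) (G x) := by
    rw [← integral_const_mul]
    refine setIntegral_mono_on (hX.const_mul c) hBG hΩ.measurableSet fun x hx => ?_
    rw [mul_left_comm]
    exact mul_le_mul_of_nonneg_left (hcoer x hx) (pow_nonneg (hψ₁ x).1 m)
  have hflux : -∫ x in Ω, w x * inner ℝ (B x) (∇ (fun y => ψ y ^ m) x) ≤ c / 2 * X + Λ * D := by
    rw [← integral_neg, ← integral_const_mul, ← integral_const_mul,
      ← integral_add (hX.const_mul _) (hD.const_mul _)]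
    refine setIntegral_mono_on hBψ.neg ((hX.const_mul _).add (hD.const_mul _)) hΩ.measurableSet
      fun x hx => ?_
    rw [gradient_fun_pow (hψ.smooth.differentiable (by simp) x)]
    exact habsorb (hM x hx) (hψ₁ x) ((hgrowth x hx).trans (by gcongr; exact le_max_left _ _))
  have hsource : ∫ x in Ω, w x * (f x * ψ x ^ m) ≤ max M 0 * F := by
    rw [← integral_const_mul]
    have hf := (hB.integrable_mul hΨ).integrableOn (s := Ω)
    refine (Real.le_norm_self _).trans (norm_integral_le_of_norm_le (hf.abs.const_mul (max M 0))
      (ae_restrict_of_forall_mem hΩ.measurableSet fun x hx => ?_))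
    rw [norm_mul]
    exact mul_le_mul_of_nonneg_right ((hM x hx).trans (le_max_left _ _)) (norm_nonneg _)
  have hF : 0 ≤ F := integral_nonneg fun x => abs_nonneg _
  have hD₀ : 0 ≤ D := integral_nonneg fun x => by positivity
  have htest := hB.integral_testing hΩ hpq hw hG hGp hΨ
  rw [mul_assoc, div_mul_eq_mul_div, le_div_iff₀ hc]
  nlinarith [mul_nonneg hΛ hF, mul_nonneg (le_max_right M 0) hD₀]

theorem norm_sub_rpow_le {E : Type*} [SeminormedAddCommGroup E] (hp : 1 ≤ p) (a b : E) :
    ‖a - b‖ ^ p ≤ 2 ^ (p - 1) * (‖a‖ ^ p + ‖b‖ ^ p) :=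
  (Real.rpow_le_rpow (norm_nonneg _) (norm_sub_le a b) (by linarith)).trans
    (mod_cast NNReal.rpow_add_le_mul_rpow_add_rpow ‖a‖₊ ‖b‖₊ hp)

/-- The cutoff function of the annulus with radii `r` and `R`: for `0 < r` and `2 * r ≤ R` it is
`1` where `2 * r ≤ ‖x‖ ≤ R`, and vanishes where `‖x‖ < r` or `2 * R ≤ ‖x‖`. -/
noncomputable def annulusCutoff (r R : ℝ) (x : EuclideanSpace ℝ (Fin n)) : ℝ :=
  cutoff R x - cutoff r x

section AnnulusCutoff

variable {r R : ℝ}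

theorem annulusCutoff_mem_Icc (hr : 0 < r) (hrR : 2 * r ≤ R) (x : 𝔼) :
    annulusCutoff r R x ∈ Icc (0 : ℝ) 1 := by
  have hle : cutoff r x ≤ cutoff R x := by
    rcases le_total ‖x‖ R with hx | hx
    · exact (cutoff_le_one r x).trans_eq (cutoff_eq_one (by linarith) hx).symm
    · exact (cutoff_eq_zero hr (hrR.trans hx)).trans_le (cutoff_nonneg R x)
  exact ⟨sub_nonneg.2 hle, (sub_le_self _ (cutoff_nonneg r x)).trans (cutoff_le_one R x)⟩

theorem annulusCutoff_eq_zero (hr : 0 < r) (hrR : 2 * r ≤ R) {x : 𝔼} (hx : ‖x‖ < r) :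
    annulusCutoff r R x = 0 := by
  rw [annulusCutoff, cutoff_eq_one (by linarith) (by linarith), cutoff_eq_one hr hx.le, sub_self]

theorem annulusCutoff_eq_one (hr : 0 < r) {x : 𝔼} (hrx : 2 * r ≤ ‖x‖) (hxR : ‖x‖ ≤ R) :
    annulusCutoff r R x = 1 := by
  rw [annulusCutoff, cutoff_eq_one (by linarith) hxR, cutoff_eq_zero hr hrx, sub_zero]

theorem isTestFunction_annulusCutoff (hr : 0 < r) (hrR : 2 * r ≤ R) (hΩ : (ball 0 r)ᶜ ⊆ Ω) :
    IsTestFunction Ω (annulusCutoff r R) where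
  smooth := (isTestFunction_cutoff (by linarith)).smooth.sub (isTestFunction_cutoff hr).smooth
  compact_support := (isTestFunction_cutoff (by linarith)).compact_support.sub
    (isTestFunction_cutoff hr).compact_support
  support_subset := by
    have hsupp : Function.support (annulusCutoff r R) ⊆ (ball (0 : 𝔼) r)ᶜ := fun x hx hxr =>
      hx (annulusCutoff_eq_zero hr hrR (mem_ball_zero_iff.1 hxr))
    exact (closure_minimal hsupp isOpen_ball.isClosed_compl).trans hΩ

theorem integral_norm_gradient_annulusCutoff_le (hp : 1 ≤ p) (hpn : (n : ℝ) ≤ p) (hr : 1 ≤ r)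
    (hR : 1 ≤ R) : ∫ x : 𝔼, ‖∇ (annulusCutoff r R) x‖ ^ p ≤
      2 ^ (p - 1) * (2 * ∫ x, ‖∇ (unitBump n) x‖ ^ p) := by
  have hp₀ : 0 < p := one_pos.trans_le hp
  have hcR := isTestFunction_cutoff (n := n) (one_pos.trans_le hR)
  have hcr := isTestFunction_cutoff (n := n) (one_pos.trans_le hr)
  have hR' := hcR.integrable_norm_gradient_rpow hp₀
  have hr' := hcr.integrable_norm_gradient_rpow hp₀
  have hgrad : ∀ x, ∇ (annulusCutoff r R) x = ∇ (cutoff R) x - ∇ (cutoff r) x := fun x =>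
    gradient_fun_sub (hcR.smooth.differentiable (by simp) x)
      (hcr.smooth.differentiable (by simp) x)
  calc ∫ x : 𝔼, ‖∇ (annulusCutoff r R) x‖ ^ p
      ≤ ∫ x : 𝔼, 2 ^ (p - 1) * (‖∇ (cutoff R) x‖ ^ p + ‖∇ (cutoff r) x‖ ^ p) :=
        integral_mono_of_nonneg (.of_forall fun x => by positivity)
          ((hR'.add hr').const_mul _)
          (.of_forall fun x => by simp only [hgrad]; exact norm_sub_rpow_le hp _ _)
    _ ≤ _ := by
        rw [integral_const_mul, integral_add hR' hr', two_mul]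
        refine mul_le_mul_of_nonneg_left (add_le_add ?_ ?_) (by positivity)
        · exact integral_norm_gradient_cutoff_le hpn hR
        · exact integral_norm_gradient_cutoff_le hpn hr

end AnnulusCutoff

theorem integrableOn_norm_ge_of_setIntegral_annulus_le {g : 𝔼 → ℝ} {r b : ℝ} (hg : ∀ x, 0 ≤ g x)
    (hgi : ∀ R, IntegrableOn g {x | r ≤ ‖x‖ ∧ ‖x‖ ≤ R} volume)
    (hb : ∀ᶠ R in atTop, ∫ x in {x | r ≤ ‖x‖ ∧ ‖x‖ ≤ R}, g x ≤ b) :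
    IntegrableOn g {x | r ≤ ‖x‖} volume := by
  have hrestrict : ∀ R : ℝ, (volume.restrict {x : 𝔼 | r ≤ ‖x‖}).restrict (closedBall 0 R) =
      volume.restrict {x | r ≤ ‖x‖ ∧ ‖x‖ ≤ R} := fun R => by
    rw [Measure.restrict_restrict measurableSet_closedBall]
    congr 1
    ext x
    simp [and_comm]
  refine (aecover_closedBall (x := (0 : 𝔼)) tendsto_id).integrable_of_integral_bounded_of_nonneg_ae
    b (fun R => ?_) (.of_forall hg) ?_
  · rw [IntegrableOn, id, hrestrict]
    exact hgi R
  · filter_upwards [hb] with R hR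
    rwa [id, hrestrict]

theorem setIntegral_abs_mul_annulusCutoff_pow_le (hΩ : MeasurableSet Ω) {m : ℕ} (hm : m ≠ 0)
    {r R : ℝ} (hr : 0 < r) (hR : 2 * r ≤ R) (hrΩ : (ball 0 r)ᶜ ⊆ Ω)
    (hf : IntegrableOn f (ball 0 r)ᶜ volume) :
    ∫ x in Ω, |f x * annulusCutoff r R x ^ m| ≤ ∫ x in (ball 0 r)ᶜ, |f x| := by
  have hψ := annulusCutoff_mem_Icc (n := n) hr hR
  rw [setIntegral_eq_of_subset_of_forall_sdiff_eq_zero hΩ hrΩ fun x hx => by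
    rw [annulusCutoff_eq_zero hr hR (by simpa using hx.2), zero_pow hm, mul_zero, abs_zero]]
  refine integral_mono_of_nonneg (.of_forall fun x => abs_nonneg _) hf.abs
    (.of_forall fun x => ?_)
  simp only [abs_mul, abs_of_nonneg (pow_nonneg (hψ x).1 m)]
  exact mul_le_of_le_one_right (abs_nonneg _) (pow_le_one₀ (hψ x).1 (hψ x).2)

theorem HasWeakNegDiv.integrableOn_norm_rpow (hΩ : IsOpen Ω) (hpq : p.HolderConjugate q)
    (hpn : (n : ℝ) ≤ p) (hB : HasWeakNegDiv Ω q B f) (hw : ContinuousOn w Ω)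
    (hM : ∀ x ∈ Ω, |w x| ≤ M) (hG : HasWeakGradient Ω w G) (hGp : MemLpLoc Ω p G)
    (hgrowth : ∀ x ∈ Ω, ‖B x‖ ≤ C * ‖G x‖ ^ (p - 1)) (hc : 0 < c)
    (hcoer : ∀ x ∈ Ω, c * ‖G x‖ ^ p ≤ inner ℝ (B x) (G x)) {r : ℝ} (hr : 1 ≤ r)
    (hrΩ : (ball 0 r)ᶜ ⊆ Ω) (hf : IntegrableOn f (ball 0 r)ᶜ volume) :
    IntegrableOn (fun x => ‖G x‖ ^ p) {x | 2 * r ≤ ‖x‖} volume := by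
  have hr₀ : 0 < r := one_pos.trans_le hr
  obtain ⟨m, hm⟩ := exists_nat_ge p
  have hm₀ : m ≠ 0 := Nat.cast_pos.1 (hpq.pos.trans_le hm) |>.ne'
  obtain ⟨Λ, hΛ, hcacc⟩ := hB.exists_caccioppoli hΩ hpq hw hM hG hGp hgrowth hc hcoer hm
  have hannulus : ∀ R, {x : 𝔼 | 2 * r ≤ ‖x‖ ∧ ‖x‖ ≤ R} ⊆ Ω := fun R x hx =>
    hrΩ (by simpa using (by linarith [hx.1] : r ≤ ‖x‖))
  have hclosed : ∀ R, IsClosed {x : 𝔼 | 2 * r ≤ ‖x‖ ∧ ‖x‖ ≤ R} := fun R =>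
    (isClosed_le continuous_const continuous_norm).inter
      (isClosed_le continuous_norm continuous_const)
  refine integrableOn_norm_ge_of_setIntegral_annulus_le (fun x => by positivity) (fun R =>
    integrable_norm_rpow_of_memLp hpq.pos (hGp _ ((isCompact_closedBall 0 R).of_isClosed_subset
      (hclosed R) fun x hx => by simpa using hx.2) (hannulus R))) ?_
    (b := Λ * ((∫ x in (ball 0 r)ᶜ, |f x|) + 2 ^ (p - 1) * (2 * ∫ x, ‖∇ (unitBump n) x‖ ^ p)))
  filter_upwards [eventually_ge_atTop (2 * r)] with R hR
  have hψ := isTestFunction_annulusCutoff hr₀ hR hrΩ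
  have hψ₁ := annulusCutoff_mem_Icc (n := n) hr₀ hR
  calc ∫ x in {x | 2 * r ≤ ‖x‖ ∧ ‖x‖ ≤ R}, ‖G x‖ ^ p
      = ∫ x in {x | 2 * r ≤ ‖x‖ ∧ ‖x‖ ≤ R}, annulusCutoff r R x ^ m * ‖G x‖ ^ p :=
        setIntegral_congr_fun (hclosed R).measurableSet fun x hx => by
          simp [annulusCutoff_eq_one hr₀ hx.1 hx.2]
    _ ≤ ∫ x in Ω, annulusCutoff r R x ^ m * ‖G x‖ ^ p :=
        setIntegral_mono_set (hGp.integrable_mul_norm_rpow hpq.pos (hψ.pow hm₀)).integrableOn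
          (.of_forall fun x => mul_nonneg (pow_nonneg (hψ₁ x).1 m) (by positivity))
          (hannulus R).eventuallyLE
    _ ≤ _ := hcacc _ hψ hψ₁
    _ ≤ _ := by
        gcongr
        · exact setIntegral_abs_mul_annulusCutoff_pow_le hΩ.measurableSet hm₀ hr₀ hR hrΩ hf
        · exact (setIntegral_le_integral (hψ.integrable_norm_gradient_rpow hpq.pos)
            (.of_forall fun x => by positivity)).trans
            (integral_norm_gradient_annulusCutoff_le hpq.lt.le hpn hr (by linarith))

end Caccioppoli

section Comparison

variable {n : ℕ} {Ω S K : Set (EuclideanSpace ℝ (Fin n))} {p q : ℝ}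
  {A : EuclideanSpace ℝ (Fin n) → EuclideanSpace ℝ (Fin n) → EuclideanSpace ℝ (Fin n)}
  {B G Gu Gv : EuclideanSpace ℝ (Fin n) → EuclideanSpace ℝ (Fin n)}
  {f f₁ f₂ u v w : EuclideanSpace ℝ (Fin n) → ℝ}

local notation "𝔼" => EuclideanSpace ℝ (Fin n)

theorem locallyIntegrableOn_compl (hK : IsClosed K)
    (hf : ∀ U, IsOpen U → K ⊆ U → IntegrableOn f Uᶜ volume) :
    LocallyIntegrableOn f Kᶜ volume := by
  rw [locallyIntegrableOn_iff hK.isOpen_compl.isLocallyClosed]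
  intro C hCK hC
  simpa using hf Cᶜ hC.isClosed.isOpen_compl (subset_compl_comm.1 hCK)

theorem MemLpLoc.continuousOn_smul (hw : ContinuousOn w Ω) (hG : MemLpLoc Ω p G) :
    MemLpLoc Ω p (fun x => w x • G x) := fun C hC hCΩ =>
  (hG C hC hCΩ).smul (memLp_restrict_of_continuousOn ⊤ hC (hw.mono hCΩ))

theorem IsWeakSolution.exists_hasWeakNegDiv (hu : IsWeakSolution Kᶜ A u f)
    (hA : StructureConditions K p A) (hpq : p.HolderConjugate q) (hK : IsClosed K)
    (hu_sob : MemW1pLoc Kᶜ p u) (hf : LocallyIntegrableOn f Kᶜ volume) :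
    ∃ G, HasWeakGradient Kᶜ u G ∧ MemLpLoc Kᶜ p G ∧
      HasWeakNegDiv Kᶜ q (fun x => A x (G x)) f := by
  obtain ⟨G, hG, hsol⟩ := hu
  obtain ⟨-, H, hH, hHp⟩ := hu_sob
  have hGp : MemLpLoc Kᶜ p G := hHp.congr_ae (hH.ae_eq hK.isOpen_compl hG)
  exact ⟨G, hG, hGp, fun C hC hCK => hA.memLp hpq hC.measurableSet hCK (hGp C hC hCK), hf,
    fun φ hφ => (hsol φ hφ).2.2⟩

theorem StructureConditions.eventually_memLp_norm_ge (hA : StructureConditions K p A)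
    (hpq : p.HolderConjugate q) (hpn : (n : ℝ) ≤ p) (hK : IsCompact K) {M : ℝ}
    (hu : ContinuousOn u Kᶜ) (hM : ∀ x ∈ Kᶜ, |u x| ≤ M) (hG : HasWeakGradient Kᶜ u G)
    (hGp : MemLpLoc Kᶜ p G) (hB : HasWeakNegDiv Kᶜ q (fun x => A x (G x)) f)
    (hf : ∀ U, IsOpen U → K ⊆ U → IntegrableOn f Uᶜ volume) :
    ∀ᶠ R in atTop, MemLp (fun x => A x (G x)) (ENNReal.ofReal q)
      (volume.restrict {x | R ≤ ‖x‖}) := by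
  obtain ⟨C, hgrowth⟩ := hA.exists_norm_le hpq.lt
  obtain ⟨c, hc, hcoer⟩ := hA.exists_le_inner hpq.lt
  obtain ⟨r, hr, hKr⟩ := hK.isBounded.subset_ball_lt 1 0
  have henergy : IntegrableOn (fun x => ‖G x‖ ^ p) {x | 2 * r ≤ ‖x‖} volume :=
    hB.integrableOn_norm_rpow hK.isClosed.isOpen_compl hpq hpn hu hM hG hGp
      (fun x hx => hgrowth x hx _) hc (fun x hx => hcoer x hx _) hr.le (compl_subset_compl.2 hKr)
      (hf _ isOpen_ball hKr)
  filter_upwards [eventually_ge_atTop (2 * r)] with R hR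
  have hRr : {x : 𝔼 | R ≤ ‖x‖} ⊆ {x | 2 * r ≤ ‖x‖} := fun x hx => hR.trans hx
  have hRK : {x : 𝔼 | R ≤ ‖x‖} ⊆ Kᶜ := fun x hx hxK => by
    linarith [mem_ball_zero_iff.1 (hKr hxK), hx.out]
  have hGm : AEStronglyMeasurable G (volume.restrict {x | R ≤ ‖x‖}) :=
    hG.locallyIntegrable_grad.aestronglyMeasurable.mono_set hRK
  refine hA.memLp hpq (measurableSet_le measurable_const measurable_norm) hRK ?_
  rw [← integrable_norm_rpow_iff hGm (ENNReal.ofReal_pos.2 hpq.pos).ne' ENNReal.ofReal_ne_top,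
    ENNReal.toReal_ofReal hpq.nonneg]
  exact henergy.mono_set hRr

theorem HasWeakNegDiv.inner_ae_eq_zero (hΩ : IsOpen Ω) (hS : IsClosed S) (hSΩ : S ⊆ Ω)
    (hpq : p.HolderConjugate q) (hpn : (n : ℝ) ≤ p) (hB : HasWeakNegDiv Ω q B f) {R₀ M : ℝ}
    (hBq : MemLp B (ENNReal.ofReal q) (volume.restrict {x | R₀ ≤ ‖x‖}))
    (hf : ∀ᵐ x ∂volume.restrict Ω, f x ≤ 0) (hw : ContinuousOn w Ω)
    (hwM : ∀ x ∈ Ω, w x ∈ Icc 0 M) (hG : HasWeakGradient Ω w G) (hGp : MemLpLoc Ω p G)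
    (hw₀ : EqOn w 0 (Ω \ S)) (hG₀ : EqOn G 0 (Ω \ S))
    (hBG : ∀ x ∈ Ω, 0 ≤ inner ℝ (B x) (G x)) :
    (fun x => inner ℝ (B x) (G x)) =ᵐ[volume.restrict Ω] 0 := by
  have hcut : ∀ k : ℕ, IsTestFunction univ (cutoff (k + 1 : ℕ) : 𝔼 → ℝ) := fun k =>
    isTestFunction_cutoff (by positivity)
  have htest := fun k => hB.testing_of_eqOn_zero hΩ hS hSΩ hpq hw hG hGp hw₀ hG₀ (hcut k)
  have hnonneg : ∀ k : ℕ,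
      0 ≤ᵐ[volume.restrict Ω] fun x => cutoff (k + 1 : ℕ) x * inner ℝ (B x) (G x) := fun k =>
    ae_restrict_of_forall_mem hΩ.measurableSet fun x hx => mul_nonneg (cutoff_nonneg _ _) (hBG x hx)
  have hle : ∀ k : ℕ, ∫ x in Ω, cutoff (k + 1 : ℕ) x * inner ℝ (B x) (G x) ≤
      -∫ x in Ω, w x * inner ℝ (B x) (∇ (cutoff (k + 1 : ℕ)) x) := fun k => by
    have hsource : ∫ x in Ω, w x * (f x * cutoff (k + 1 : ℕ) x) ≤ 0 := by
      refine integral_nonpos_of_ae ?_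
      filter_upwards [hf, ae_restrict_mem hΩ.measurableSet] with x hfx hx
      exact mul_nonpos_of_nonneg_of_nonpos (hwM x hx).1
        (mul_nonpos_of_nonpos_of_nonneg hfx (cutoff_nonneg _ _))
    linarith [(htest k).2]
  have hflux := ((tendsto_add_atTop_iff_nat 1).2 <| tendsto_setIntegral_mul_inner_gradient_cutoff
    hpq hpn hΩ.measurableSet (w := w) (M := M)
    (fun x hx => (abs_of_nonneg (hwM x hx).1).trans_le (hwM x hx).2) hBq).neg
  rw [neg_zero] at hflux
  refine ae_eq_zero_of_tendsto_integral_zero hnonneg (fun k => (htest k).1)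
    (squeeze_zero (fun k => integral_nonneg_of_ae (hnonneg k)) hle hflux) (.of_forall fun x => ?_)
  obtain ⟨k₀, hk₀⟩ := exists_nat_ge ‖x‖
  refine tendsto_const_nhds.congr' ?_
  filter_upwards [eventually_ge_atTop k₀] with k hk
  have hxk : ‖x‖ ≤ (k + 1 : ℕ) := hk₀.trans (by exact_mod_cast hk.trans k.le_succ)
  rw [cutoff_eq_one (by positivity) hxk, one_mul]

theorem HasWeakGradient.eqOn_zero_of_ae_eq_zero (hΩ : IsOpen Ω) (hΩ' : Ωᶜ.Nonempty)
    (hS : IsClosed S) (hSΩ : S ⊆ Ω) (hw : ContinuousOn w Ω) (hG : HasWeakGradient Ω w G)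
    (hw₀ : EqOn w 0 (Ω \ S)) (hG₀ : EqOn G 0 (Ω \ S)) (hGz : G =ᵐ[volume.restrict Ω] 0) :
    EqOn w 0 Ω := by
  have hcont : Continuous (Ω.indicator w) := by
    refine continuous_iff_continuousAt.2 fun x => ?_
    by_cases hx : x ∈ Ω
    · refine (hw.continuousAt (hΩ.mem_nhds hx)).congr ?_
      filter_upwards [hΩ.mem_nhds hx] with y hy using (indicator_of_mem hy w).symm
    · refine (continuousAt_const (y := (0 : ℝ))).congr ?_
      filter_upwards [hS.isOpen_compl.mem_nhds fun hxS => hx (hSΩ hxS)] with y hy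
      by_cases hyΩ : y ∈ Ω
      · rw [indicator_of_mem hyΩ, hw₀ ⟨hyΩ, hy⟩, Pi.zero_apply]
      · rw [indicator_of_notMem hyΩ]
  obtain ⟨y, hy⟩ := hΩ'
  intro x hx
  simpa [hx, notMem_of_mem_compl hy] using
    (hG.indicator hΩ hS hSΩ hw₀ hG₀).eq_of_ae_eq_zero hcont
      (indicator_ae_eq_zero_of_restrict_ae_eq_zero hΩ.measurableSet hGz) x y

theorem StructureConditions.inner_smul_sub_nonneg (hA : StructureConditions K p A) {x : 𝔼}
    (hx : x ∈ Kᶜ) (a b : 𝔼) {t : ℝ} (ht : 0 ≤ t) :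
    0 ≤ inner ℝ (A x b - A x a) (t • (b - a)) := by
  rw [real_inner_smul_right]
  rcases eq_or_ne a b with rfl | hab
  · simp
  · exact mul_nonneg ht (hA.inner_sub_pos hx hab).le

theorem StructureConditions.smul_sub_eq_zero (hA : StructureConditions K p A) {x : 𝔼}
    (hx : x ∈ Kᶜ) {a b : 𝔼} {t : ℝ} (h : inner ℝ (A x b - A x a) (t • (b - a)) = 0) :
    t • (b - a) = 0 := by
  by_contra! hne
  rw [real_inner_smul_right] at h
  have hab : a ≠ b := fun hab => hne (by rw [hab, sub_self, smul_zero])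
  exact mul_ne_zero (smul_ne_zero_iff.1 hne).1 (hA.inner_sub_pos hx hab).ne' h

theorem isClosed_superlevel (hw : ContinuousOn w (closure Kᶜ)) (ε : ℝ) :
    IsClosed {x ∈ closure Kᶜ | ε ≤ w x} :=
  hw.preimage_isClosed_of_isClosed isClosed_closure isClosed_Ici

theorem superlevel_subset_compl (hw : ∀ x ∈ frontier K, w x ≤ 0) {ε : ℝ} (hε : 0 < ε) :
    {x ∈ closure Kᶜ | ε ≤ w x} ⊆ Kᶜ := fun x hx hxK => by
  have hxf : x ∈ frontier K := by
    rw [frontier_eq_closure_inter_closure]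
    exact ⟨subset_closure hxK, hx.1⟩
  linarith [hw x hxf, hx.2]

theorem exists_smooth_truncation (ε : ℝ) :
    ∃ h : ℝ → ℝ, ContDiff ℝ 1 h ∧ Monotone h ∧ (∀ t, h t ∈ Icc 0 1) ∧
      (∀ t < ε, h t = 0 ∧ deriv h t = 0) ∧ ∀ t, ε < t → h t ≠ 0 := by
  have hzero : ∀ t < ε, Real.smoothTransition (t - ε) = 0 := fun t ht =>
    Real.smoothTransition.zero_of_nonpos (sub_neg.2 ht).le
  refine ⟨fun t => Real.smoothTransition (t - ε), Real.smoothTransition.contDiff.comp (by fun_prop),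
    fun s t hst => Real.smoothTransition.monotone (sub_le_sub_right hst ε),
    fun t => ⟨Real.smoothTransition.nonneg _, Real.smoothTransition.le_one _⟩,
    fun t ht => ⟨hzero t ht, ?_⟩,
    fun t ht => (Real.smoothTransition.pos_of_pos (sub_pos.2 ht)).ne'⟩
  have hev : (fun t => Real.smoothTransition (t - ε)) =ᶠ[𝓝 t] fun _ => 0 := by
    filter_upwards [Iio_mem_nhds ht] with s hs using hzero s hs
  rw [hev.deriv_eq, deriv_const]

theorem StructureConditions.comp_sub_eqOn_zero (hA : StructureConditions K p A)
    (hpq : p.HolderConjugate q) (hpn : (n : ℝ) ≤ p) (hK : IsClosed K) (hK_ne : K.Nonempty)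
    (hu : ContinuousOn u Kᶜ) (hv : ContinuousOn v Kᶜ) (hGu : HasWeakGradient Kᶜ u Gu)
    (hGv : HasWeakGradient Kᶜ v Gv) (hGup : MemLpLoc Kᶜ p Gu) (hGvp : MemLpLoc Kᶜ p Gv)
    (hBu : HasWeakNegDiv Kᶜ q (fun x => A x (Gu x)) f₁)
    (hBv : HasWeakNegDiv Kᶜ q (fun x => A x (Gv x)) f₂)
    (hf : ∀ᵐ x ∂volume.restrict Kᶜ, f₁ x ≤ f₂ x) {R₀ M : ℝ}
    (hBq : MemLp (fun x => A x (Gu x) - A x (Gv x)) (ENNReal.ofReal q)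
      (volume.restrict {x | R₀ ≤ ‖x‖})) (hS : IsClosed S) (hSK : S ⊆ Kᶜ) {h : ℝ → ℝ}
    (hh : ContDiff ℝ 1 h) (hmono : Monotone h) (hhM : ∀ t, h t ∈ Icc 0 M)
    (hhS : ∀ x ∈ Kᶜ \ S, h (u x - v x) = 0 ∧ deriv h (u x - v x) = 0) :
    EqOn (fun x => h (u x - v x)) 0 Kᶜ := by
  have hKo : IsOpen Kᶜ := hK.isOpen_compl
  have hw : ContinuousOn (fun x => h (u x - v x)) Kᶜ :=
    hh.continuous.comp_continuousOn (hu.sub hv)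
  have hG : HasWeakGradient Kᶜ (fun x => h (u x - v x))
      (fun x => deriv h (u x - v x) • (Gu x - Gv x)) := (hGu.sub hGv).comp hKo (hu.sub hv) hh
  have hGp : MemLpLoc Kᶜ p (fun x => deriv h (u x - v x) • (Gu x - Gv x)) :=
    (hGup.sub hGvp).continuousOn_smul
      ((hh.continuous_deriv le_rfl).comp_continuousOn (hu.sub hv))
  have hw₀ : EqOn (fun x => h (u x - v x)) 0 (Kᶜ \ S) := fun x hx => (hhS x hx).1
  have hG₀ : EqOn (fun x => deriv h (u x - v x) • (Gu x - Gv x)) 0 (Kᶜ \ S) := fun x hx => by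
    simp only [(hhS x hx).2, zero_smul, Pi.zero_apply]
  have hinner := (hBu.sub hpq hBv).inner_ae_eq_zero hKo hS hSK hpq hpn hBq
    (hf.mono fun x => sub_nonpos.2) hw (fun x _ => hhM _) hG hGp hw₀ hG₀
    fun x hx => hA.inner_smul_sub_nonneg hx _ _ hmono.deriv_nonneg
  refine hG.eqOn_zero_of_ae_eq_zero hKo (by rwa [compl_compl]) hS hSK hw hw₀ hG₀ ?_
  filter_upwards [hinner, ae_restrict_mem hKo.measurableSet] with x hx hxK
  exact hA.smul_sub_eq_zero hxK hx

end Comparison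

end ExteriorComparison

open ExteriorComparison in
theorem corollary4p8_general {n : ℕ} {p : ℝ} (hp₁ : 1 < p) (hp : (n : ℝ) ≤ p)
    {K : Set (EuclideanSpace ℝ (Fin n))} (hK : IsCompact K) (hK_ne : K.Nonempty)
    {A : EuclideanSpace ℝ (Fin n) → EuclideanSpace ℝ (Fin n) → EuclideanSpace ℝ (Fin n)}
    (hA : StructureConditions K p A) {u v f₁ f₂ : EuclideanSpace ℝ (Fin n) → ℝ}
    (hu_cont : ContinuousOn u (closure Kᶜ)) (hv_cont : ContinuousOn v (closure Kᶜ))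
    (hu_bdd : ∃ M : ℝ, ∀ x ∈ Kᶜ, |u x| ≤ M) (hv_bdd : ∃ M : ℝ, ∀ x ∈ Kᶜ, |v x| ≤ M)
    (hu_sob : MemW1pLoc Kᶜ p u) (hv_sob : MemW1pLoc Kᶜ p v)
    (hf₁ : ∀ U, IsOpen U → K ⊆ U → IntegrableOn f₁ Uᶜ volume)
    (hf₂ : ∀ U, IsOpen U → K ⊆ U → IntegrableOn f₂ Uᶜ volume)
    (hf : ∀ᵐ x ∂volume.restrict Kᶜ, f₁ x ≤ f₂ x)
    (hu_sol : IsWeakSolution Kᶜ A u f₁) (hv_sol : IsWeakSolution Kᶜ A v f₂)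
    (h_bdry : ∀ x ∈ frontier K, u x ≤ v x) :
    ∀ x ∈ Kᶜ, u x ≤ v x := by
  have hpq := Real.HolderConjugate.conjExponent hp₁
  have hu := hu_cont.mono subset_closure
  have hv := hv_cont.mono subset_closure
  obtain ⟨Mu, hMu⟩ := hu_bdd
  obtain ⟨Mv, hMv⟩ := hv_bdd
  obtain ⟨Gu, hGu, hGup, hBu⟩ := hu_sol.exists_hasWeakNegDiv hA hpq hK.isClosed hu_sob
    (locallyIntegrableOn_compl hK.isClosed hf₁)
  obtain ⟨Gv, hGv, hGvp, hBv⟩ := hv_sol.exists_hasWeakNegDiv hA hpq hK.isClosed hv_sob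
    (locallyIntegrableOn_compl hK.isClosed hf₂)
  obtain ⟨R₀, hBuq, hBvq⟩ :=
    ((hA.eventually_memLp_norm_ge hpq hp hK hu hMu hGu hGup hBu hf₁).and
      (hA.eventually_memLp_norm_ge hpq hp hK hv hMv hGv hGvp hBv hf₂)).exists
  by_contra! ⟨x₀, hx₀, hlt⟩
  obtain ⟨ε, hε, hεx₀⟩ := exists_between (sub_pos.2 hlt)
  obtain ⟨h, hh, hmono, hh₁, hh₀, hhε⟩ := exists_smooth_truncation ε
  refine hhε _ hεx₀ (hA.comp_sub_eqOn_zero hpq hp hK.isClosed hK_ne hu hv hGu hGv hGup hGvp hBu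
    hBv hf (hBuq.sub hBvq) (isClosed_superlevel (hu_cont.sub hv_cont) ε)
    (superlevel_subset_compl (fun x hx => sub_nonpos.2 (h_bdry x hx)) hε) hh hmono hh₁
    (fun x hx => hh₀ _ ?_) hx₀)
  exact not_le.1 fun hle => hx.2 ⟨subset_closure hx.1, hle⟩

theorem corollary4p8 {n : ℕ} (hn : 2 ≤ n) {p : ℝ} (hp : (n : ℝ) ≤ p)
    {K : Set (EuclideanSpace ℝ (Fin n))} (hK : IsCompact K) (hK_ne : K.Nonempty)
    {A : EuclideanSpace ℝ (Fin n) → EuclideanSpace ℝ (Fin n) → EuclideanSpace ℝ (Fin n)}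
    (hA : ExteriorComparison.StructureConditions K p A)
    {u v f₁ f₂ : EuclideanSpace ℝ (Fin n) → ℝ}
    (hu_cont : ContinuousOn u (closure Kᶜ)) (hv_cont : ContinuousOn v (closure Kᶜ))
    (hu_bdd : ∃ M : ℝ, ∀ x ∈ Kᶜ, |u x| ≤ M) (hv_bdd : ∃ M : ℝ, ∀ x ∈ Kᶜ, |v x| ≤ M)
    (hu_sob : ExteriorComparison.MemW1pLoc Kᶜ p u)
    (hv_sob : ExteriorComparison.MemW1pLoc Kᶜ p v)
    (hf₁ : ∀ U : Set (EuclideanSpace ℝ (Fin n)), IsOpen U → K ⊆ U →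
      MeasureTheory.IntegrableOn f₁ Uᶜ MeasureTheory.volume)
    (hf₂ : ∀ U : Set (EuclideanSpace ℝ (Fin n)), IsOpen U → K ⊆ U →
      MeasureTheory.IntegrableOn f₂ Uᶜ MeasureTheory.volume)
    (hf : ∀ᵐ x ∂(MeasureTheory.volume.restrict Kᶜ), f₁ x ≤ f₂ x)
    (hu_sol : ExteriorComparison.IsWeakSolution Kᶜ A u f₁)
    (hv_sol : ExteriorComparison.IsWeakSolution Kᶜ A v f₂)
    (h_bdry : ∀ x ∈ frontier K, u x ≤ v x) :
    ∀ x ∈ Kᶜ, u x ≤ v x :=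
  corollary4p8_general (one_lt_two.trans_le ((Nat.ofNat_le_cast.2 hn).trans hp)) hp hK hK_ne hA
    hu_cont hv_cont hu_bdd hv_bdd hu_sob hv_sob hf₁ hf₂ hf hu_sol hv_sol h_bdry
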